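/- Let $(M^n,g)$ be a smooth Riemannian manifold of dimension $n\ge 3$ and let $\xi$ be a conformal vector field on $M$, i.e. a smooth vector field with $\mathcal L_\xi g=2f\,g$ for a smooth function $f$, the characteristic function of $\xi$. Conventions (local coordinates, summation convention, indices raised with $g^{ij}$, a comma denotes the Levi-Civita covariant derivative): $R(X,Y)Z=\nabla_X\nabla_YZ-\nabla_Y\nabla_XZ-\nabla_{[X,Y]}Z$, $R(\partial_j,\partial_k)\partial_i=R^l_{ijk}\partial_l$, $R_{ijkl}=g_{is}R^s_{jkl}$, $R_{ij}=g^{kl}R_{ikjl}$ is the Ricci tensor $\mathrm{Ric}$ and $\mathrm R=g^{ij}R_{ij}$ the scalar curvature; $A=\mathrm{Ric}-\frac{\mathrm R}{2(n-1)}g$ and $C_{ijk}=A_{ij,k}-A_{ik,j}$ is the Cotton tensor; $\Delta f=\mathrm{tr}_g\,\mathrm{Hess} f$ and $\mathcal L_g^*f=\mathrm{Hess} f-(\Delta f)g-f\,\mathrm{Ric}$; $\xi^\flat_i=g_{ij}\xi^j$, $\mathcal P_{jk}=\frac12(\xi^\flat_{j,k}-\xi^\flat_{k,j})$, and $(\mathrm{div}\,\mathcal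 P)_k=g^{jl}\mathcal P_{jk,l}$. Then there is a smooth symmetric $(0,2)$-tensor field $\Phi$ on $M$ whose components in every local coordinate system are $$\Phi_{ik}=-C_{kli}\,\xi^l-\frac1{2(n-1)}\bigl(\partial_i\mathrm R\;\xi^\flat_k-\xi(\mathrm R)\,g_{ik}\bigr)+(\mathrm{div}\,\mathcal P)_{k,i}+R_{il}\,g^{lm}\mathcal P_{mk},$$ and $$\mathcal L_g^*f=\Phi\quad\text{on }M.$$ In particular, for every $p\in M$, the function $f$ satisfies the vacuum static equation $\mathrm{Hess} f-(\Delta f)g=f\,\mathrm{Ric}$ at $p$ if and only if $\Phi$ vanishes at $p$. Moreover, if $\xi$ is closed ($d\xi^\flat=0$) and $\mathrm R$ is constant, then $\Phi=-C(\cdot,\xi,\cdot)$. -/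

import Mathlib

open scoped Manifold ContDiff Bundle

noncomputable section

namespace Riem

/-! ### Tensor calculus in coordinates

A Riemannian metric on a coordinate domain is given by its coefficient matrix `G`, a covector field
by `α i`, a vector field by `X i`, a `(0,2)`-tensor by `T i j`; all components are functions on
coordinate space. -/

/-- Coordinate space. -/
abbrev Coord (n : ℕ) := EuclideanSpace ℝ (Fin n)

variable {n : ℕ}

/-- The partial derivative `∂ᵢ u`. -/
def pd (i : Fin n) (u : Coord n → ℝ) (x : Coord n) : ℝ :=
  fderiv ℝ u x (EuclideanSpace.single i 1)

/-- The entries `g^{ij}` of the inverse matrix of `(g_{ij})`. -/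
def gInv (G : Coord n → Matrix (Fin n) (Fin n) ℝ) (i j : Fin n) (x : Coord n) : ℝ :=
  (G x)⁻¹ i j

/-- The Christoffel symbols `Γ^k_{ij}` of the Levi-Civita connection,
`∇_{∂ᵢ} ∂ⱼ = Γ^k_{ij} ∂ₖ`. -/
def christoffel (G : Coord n → Matrix (Fin n) (Fin n) ℝ) (k i j : Fin n) (x : Coord n) : ℝ :=
  (1 / 2) * ∑ l, gInv G k l x *
    (pd i (fun y => G y j l) x + pd j (fun y => G y i l) x - pd l (fun y => G y i j) x)

/-- The covariant derivative `α_{i,j} = (∇_{∂ⱼ} α)(∂ᵢ)` of a covector field. -/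
def covDeriv₁ (G : Coord n → Matrix (Fin n) (Fin n) ℝ) (α : Fin n → Coord n → ℝ)
    (i j : Fin n) (x : Coord n) : ℝ :=
  pd j (α i) x - ∑ l, christoffel G l j i x * α l x

/-- The covariant derivative `T_{ij,k} = (∇_{∂ₖ} T)(∂ᵢ, ∂ⱼ)` of a `(0,2)`-tensor field. -/
def covDeriv₂ (G : Coord n → Matrix (Fin n) (Fin n) ℝ) (T : Fin n → Fin n → Coord n → ℝ)
    (i j k : Fin n) (x : Coord n) : ℝ :=
  pd k (T i j) x - (∑ l, christoffel G l k i x * T l j x) - ∑ l, christoffel G l k j x * T i l x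

/-- The components `R^l_{ijk}` of the curvature tensor: `R(∂ⱼ, ∂ₖ) ∂ᵢ = R^l_{ijk} ∂ₗ`, where
`R(X, Y) Z = ∇_X ∇_Y Z - ∇_Y ∇_X Z - ∇_{[X, Y]} Z`. -/
def riemann (G : Coord n → Matrix (Fin n) (Fin n) ℝ) (l i j k : Fin n) (x : Coord n) : ℝ :=
  pd j (christoffel G l k i) x - pd k (christoffel G l j i) x
    + ∑ m, (christoffel G l j m x * christoffel G m k i x
      - christoffel G l k m x * christoffel G m j i x)

/-- The `(0,4)`-curvature tensor `R_{ijkl} = g_{is} R^s_{jkl}`. -/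
def riemannLow (G : Coord n → Matrix (Fin n) (Fin n) ℝ) (i j k l : Fin n) (x : Coord n) : ℝ :=
  ∑ s, G x i s * riemann G s j k l x

/-- The Ricci tensor `R_{ij} = g^{kl} R_{ikjl}`. -/
def ricci (G : Coord n → Matrix (Fin n) (Fin n) ℝ) (i j : Fin n) (x : Coord n) : ℝ :=
  ∑ k, ∑ l, gInv G k l x * riemannLow G i k j l x

/-- The scalar curvature `R = g^{ij} R_{ij}`. -/
def scalarCurv (G : Coord n → Matrix (Fin n) (Fin n) ℝ) (x : Coord n) : ℝ :=
  ∑ i, ∑ j, gInv G i j x * ricci G i j x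

/-- The (unnormalised) Schouten tensor `A = Ric - R / (2 (n - 1)) g`. -/
def schouten (G : Coord n → Matrix (Fin n) (Fin n) ℝ) (i j : Fin n) (x : Coord n) : ℝ :=
  ricci G i j x - scalarCurv G x / (2 * ((n : ℝ) - 1)) * G x i j

/-- The Cotton tensor `C_{ijk} = A_{ij,k} - A_{ik,j}`. -/
def cotton (G : Coord n → Matrix (Fin n) (Fin n) ℝ) (i j k : Fin n) (x : Coord n) : ℝ :=
  covDeriv₂ G (schouten G) i j k x - covDeriv₂ G (schouten G) i k j x

/-- The Hessian `f_{ij} = ∂ᵢ ∂ⱼ f - (∇_{∂ᵢ} ∂ⱼ) f`. -/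
def hess (G : Coord n → Matrix (Fin n) (Fin n) ℝ) (f : Coord n → ℝ) (i j : Fin n)
    (x : Coord n) : ℝ :=
  pd i (pd j f) x - ∑ k, christoffel G k i j x * pd k f x

/-- The Laplace-Beltrami operator `Δ f = g^{ij} f_{ij}`. -/
def laplacian (G : Coord n → Matrix (Fin n) (Fin n) ℝ) (f : Coord n → ℝ) (x : Coord n) : ℝ :=
  ∑ i, ∑ j, gInv G i j x * hess G f i j x

/-- The operator `L_g^* f = Hess f - (Δ f) g - f Ric`. -/
def lStar (G : Coord n → Matrix (Fin n) (Fin n) ℝ) (f : Coord n → ℝ) (i j : Fin n)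
    (x : Coord n) : ℝ :=
  hess G f i j x - laplacian G f x * G x i j - f x * ricci G i j x

/-- The Lie derivative of the metric,
`(L_X g)_{ij} = X^k ∂ₖ g_{ij} + g_{kj} ∂ᵢ X^k + g_{ik} ∂ⱼ X^k`. -/
def lieDerivMetric (G : Coord n → Matrix (Fin n) (Fin n) ℝ) (X : Fin n → Coord n → ℝ)
    (i j : Fin n) (x : Coord n) : ℝ :=
  ∑ k, (X k x * pd k (fun y => G y i j) x + G x k j * pd i (X k) x + G x i k * pd j (X k) x)

/-- The dual one-form `X^♭_i = g_{ij} X^j` of a vector field. -/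
def flat (G : Coord n → Matrix (Fin n) (Fin n) ℝ) (X : Fin n → Coord n → ℝ) (i : Fin n)
    (x : Coord n) : ℝ :=
  ∑ j, G x i j * X j x

/-- The skew part `P_{jk} = (X^♭_{j,k} - X^♭_{k,j}) / 2` of the covariant derivative of a vector
field. -/
def skewPart (G : Coord n → Matrix (Fin n) (Fin n) ℝ) (X : Fin n → Coord n → ℝ) (j k : Fin n)
    (x : Coord n) : ℝ :=
  (1 / 2) * (covDeriv₁ G (flat G X) j k x - covDeriv₁ G (flat G X) k j x)

/-- The divergence `(div P)_k = g^{jl} P_{jk,l}` of the skew part. -/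
def divSkewPart (G : Coord n → Matrix (Fin n) (Fin n) ℝ) (X : Fin n → Coord n → ℝ) (k : Fin n)
    (x : Coord n) : ℝ :=
  ∑ j, ∑ l, gInv G j l x * covDeriv₂ G (skewPart G X) j k l x

/-- The tensor
`Φ_{ik} = - C_{kli} X^l - (∂ᵢ R X^♭_k - X(R) g_{ik}) / (2 (n - 1)) + (div P)_{k,i}
  + R_{il} g^{lm} P_{mk}`. -/
def phi (G : Coord n → Matrix (Fin n) (Fin n) ℝ) (X : Fin n → Coord n → ℝ) (i k : Fin n)
    (x : Coord n) : ℝ :=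
  - (∑ l, cotton G k l i x * X l x)
    - 1 / (2 * ((n : ℝ) - 1)) *
      (pd i (scalarCurv G) x * flat G X k x - (∑ l, X l x * pd l (scalarCurv G) x) * G x i k)
    + covDeriv₁ G (divSkewPart G X) k i x
    + ∑ l, ∑ m, ricci G i l x * gInv G l m x * skewPart G X m k x

/-! ### Riemannian manifolds -/

variable {M : Type*} [TopologicalSpace M] [ChartedSpace (Coord n) M]

/-- `e` is a chart of the smooth manifold `M`, i.e. a member of its maximal smooth atlas. -/
def IsChart (e : OpenPartialHomeomorph M (Coord n)) : Prop :=
  e ∈ IsManifold.maximalAtlas (𝓡 n) ∞ M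

/-- The coordinate vector `∂ᵢ` of the chart `e`, at the point with coordinates `x`. -/
def coordVec (e : OpenPartialHomeomorph M (Coord n)) (i : Fin n) (x : Coord n) :
    TangentSpace (𝓡 n) (e.symm x) :=
  mfderiv (𝓡 n) (𝓡 n) e.symm x (EuclideanSpace.single i 1 : Coord n)

/-- The components `ξ^i` of a vector field in the chart `e`. -/
def vecComp (e : OpenPartialHomeomorph M (Coord n)) (ξ : (p : M) → TangentSpace (𝓡 n) p)
    (i : Fin n) (x : Coord n) : ℝ :=
  let v : Coord n := mfderiv (𝓡 n) (𝓡 n) e (e.symm x) (ξ (e.symm x))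
  v i

/-- A `(0,2)`-tensor field on `M`. -/
abbrev Tensor02 (n : ℕ) (M : Type*) [TopologicalSpace M] [ChartedSpace (Coord n) M] :=
  (p : M) → TangentSpace (𝓡 n) p →L[ℝ] TangentSpace (𝓡 n) p →L[ℝ] ℝ

/-- The components `T_{ij} = T(∂ᵢ, ∂ⱼ)` of a `(0,2)`-tensor field in the chart `e`. -/
def tensorComp (e : OpenPartialHomeomorph M (Coord n)) (T : Tensor02 n M) (i j : Fin n)
    (x : Coord n) : ℝ :=
  T (e.symm x) (coordVec e i x) (coordVec e j x)

variable [IsManifold (𝓡 n) ∞ M]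

/-- Smoothness of a `(0,2)`-tensor field, as a section of the bundle of bilinear forms. -/
def Tensor02.Smooth (T : Tensor02 n M) : Prop :=
  ContMDiff (𝓡 n) ((𝓡 n).prod 𝓘(ℝ, Coord n →L[ℝ] Coord n →L[ℝ] ℝ)) ∞
    (fun p => Bundle.TotalSpace.mk' (Coord n →L[ℝ] Coord n →L[ℝ] ℝ)
      (E := fun p : M => TangentSpace (𝓡 n) p →L[ℝ] TangentSpace (𝓡 n) p →L[ℝ] ℝ) p (T p))

/-- A smooth Riemannian metric on `M`. -/
abbrev Metric (n : ℕ) (M : Type*) [TopologicalSpace M] [ChartedSpace (Coord n) M]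
    [IsManifold (𝓡 n) ∞ M] :=
  Bundle.ContMDiffRiemannianMetric (𝓡 n) ∞ (Coord n) (fun p : M => TangentSpace (𝓡 n) p)

/-- The coefficient matrix `g_{ij} = g(∂ᵢ, ∂ⱼ)` in the chart `e`. -/
def metricComp (g : Metric n M) (e : OpenPartialHomeomorph M (Coord n)) (x : Coord n) :
    Matrix (Fin n) (Fin n) ℝ :=
  Matrix.of fun i j => tensorComp e g.inner i j x

/-- `ξ` is a (smooth) conformal vector field with (smooth) characteristic function `f`:
`L_ξ g = 2 f g`. -/
structure IsConformal (g : Metric n M) (ξ : (p : M) → TangentSpace (𝓡 n) p) (f : M → ℝ) :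
    Prop where
  smooth_field : ContMDiff (𝓡 n) (𝓡 n).tangent ∞ (fun p => (⟨p, ξ p⟩ : TangentBundle (𝓡 n) M))
  smooth_char : ContMDiff (𝓡 n) 𝓘(ℝ) ∞ f
  lie_eq : ∀ e : OpenPartialHomeomorph M (Coord n), IsChart e → ∀ x ∈ e.target, ∀ i j,
    lieDerivMetric (metricComp g e) (vecComp e ξ) i j x
      = 2 * f (e.symm x) * metricComp g e x i j

/-- The vector field `ξ` is closed: `d ξ^♭ = 0`. -/
def IsClosedField (g : Metric n M) (ξ : (p : M) → TangentSpace (𝓡 n) p) : Prop :=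
  ∀ e : OpenPartialHomeomorph M (Coord n), IsChart e → ∀ x ∈ e.target, ∀ i j,
    pd i (flat (metricComp g e) (vecComp e ξ) j) x
      = pd j (flat (metricComp g e) (vecComp e ξ) i) x

/-- The scalar curvature of `g` is constant on `M`. -/
def HasConstantScalarCurvature (g : Metric n M) : Prop :=
  ∃ c : ℝ, ∀ e : OpenPartialHomeomorph M (Coord n), IsChart e → ∀ x ∈ e.target,
    scalarCurv (metricComp g e) x = c

/-- `f` satisfies the vacuum static equation `Hess f - (Δ f) g = f Ric` at the point `p`. -/
def VacuumStaticAt (g : Metric n M) (f : M → ℝ) (p : M) : Prop :=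
  ∀ e : OpenPartialHomeomorph M (Coord n), IsChart e → p ∈ e.source → ∀ i j,
    hess (metricComp g e) (f ∘ e.symm) i j (e p)
        - laplacian (metricComp g e) (f ∘ e.symm) (e p) * metricComp g e (e p) i j
      = f p * ricci (metricComp g e) i j (e p)

end Riem

end

/-!
The tensor `Φ` is `L_g^* f = Hess f - (Δ f) g - f Ric` itself, and the theorem splits into a
pointwise identity in each chart and the fact that `L_g^* f` is a smooth tensor field.

*The identity.* The Levi-Civita connection is described by its Christoffel map `Γ(u, v)`, and
everything is written with directional derivatives of maps on coordinate space, without indices.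
For a conformal field the Lie derivative of `∇ g = 0`, together with the Koszul trick, gives
`L_ξ Γ (u, v) = df(u) v + df(v) u - g(u, v) grad f` (`IsLeviCivitaOn.lieConn_eq`). Two consequences
carry the proof.

* The Lie derivative of the curvature is the skew part of `∇ (L_ξ Γ)` (`lie_curv`), and its trace is
  `L_ξ Ric = - (n - 2) Hess f - (Δ f) g` (`IsLeviCivitaOn.lie_ric`). No Bianchi identity for
  `∇ R` is needed.
* `∇²_{u, v} ξ = L_ξ Γ (u, v) + R(u, ξ) v` (`dirD_covField`), and its trace gives
  `div P = (n - 1) df + Ric(ξ, ·)` (`IsMetricOn.divSkewPart_eq`).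

Substituting the second fact into the definition of `Φ`, the derivatives of the scalar curvature
cancel against those in the Cotton tensor, and what is left is `L_ξ Ric + (n - 1) Hess f - f Ric`.
By the first fact this is `L_g^* f` (`IsMetricOn.lStar_eq_phi`).

*Globalization.* A change of charts is an isometry between coordinate expressions of the metric.
The Koszul argument gives the transformation law of `Γ` (`IsIsometryOn.conn_law`); differentiating
it yields the law of the curvature (`IsIsometryOn.curv_law`), and hence `Ric`, `Hess f` and `Δ f`
transform as tensors (`IsIsometryOn.lStarForm_law`). So the forms `L_g^* f` in the preferred charts
define one tensor field, which the same coordinate formula computes in every chart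
(`lStarTensor_chartSymmD`); it is smooth because its components are.
-/

noncomputable section

namespace Riem

/-! ### Directional derivatives -/

section Calculus

variable {E E₁ E₂ F : Type*} [NormedAddCommGroup E] [NormedSpace ℝ E]
  [NormedAddCommGroup E₁] [NormedSpace ℝ E₁] [NormedAddCommGroup E₂] [NormedSpace ℝ E₂]
  [NormedAddCommGroup F] [NormedSpace ℝ F]

/-- The derivative `D_w f` of `f` in the fixed direction `w`, as a function of the point. -/
def dirD (w : E) (f : E → F) (x : E) : F := fderiv ℝ f x w

theorem differentiableAt_of_smooth {f : E → F} {x : E} (hf : ContDiffAt ℝ ∞ f x) :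
    DifferentiableAt ℝ f x :=
  hf.differentiableAt (by simp)

/-- The derivative at a point of a smooth map is smooth at that point. -/
theorem contDiffAt_dirD {f : E → F} {x : E} (hf : ContDiffAt ℝ ∞ f x) (w : E) :
    ContDiffAt ℝ ∞ (dirD w f) x :=
  (hf.fderiv_right (m := ∞) (by simp)).clm_apply contDiffAt_const

theorem dirD_add_dir (u v : E) (f : E → F) (x : E) :
    dirD (u + v) f x = dirD u f x + dirD v f x := by
  simp [dirD]

theorem dirD_sub_dir (u v : E) (f : E → F) (x : E) :
    dirD (u - v) f x = dirD u f x - dirD v f x := by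
  simp [dirD]

theorem dirD_smul_dir (c : ℝ) (v : E) (f : E → F) (x : E) :
    dirD (c • v) f x = c • dirD v f x := by
  simp [dirD]

theorem dirD_const (w : E) (c : F) (x : E) : dirD w (fun _ => c) x = 0 := by
  simp [dirD]

theorem dirD_congr {f f' : E → F} {x : E} (h : f =ᶠ[nhds x] f') (w : E) :
    dirD w f x = dirD w f' x := by
  rw [dirD, dirD, h.fderiv_eq]

theorem dirD_add {f f' : E → F} {x : E} (hf : DifferentiableAt ℝ f x)
    (hf' : DifferentiableAt ℝ f' x) (w : E) :
    dirD w (fun y => f y + f' y) x = dirD w f x + dirD w f' x := by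
  simp [dirD, fderiv_fun_add hf hf']

theorem dirD_sub {f f' : E → F} {x : E} (hf : DifferentiableAt ℝ f x)
    (hf' : DifferentiableAt ℝ f' x) (w : E) :
    dirD w (fun y => f y - f' y) x = dirD w f x - dirD w f' x := by
  simp [dirD, fderiv_fun_sub hf hf']

theorem dirD_smul {c : E → ℝ} {f : E → F} {x : E} (hc : DifferentiableAt ℝ c x)
    (hf : DifferentiableAt ℝ f x) (w : E) :
    dirD w (fun y => c y • f y) x = dirD w c x • f x + c x • dirD w f x := by
  simp [dirD, fderiv_fun_smul hc hf, add_comm]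

theorem dirD_mul {c f : E → ℝ} {x : E} (hc : DifferentiableAt ℝ c x)
    (hf : DifferentiableAt ℝ f x) (w : E) :
    dirD w (fun y => c y * f y) x = dirD w c x * f x + c x * dirD w f x :=
  dirD_smul hc hf w

theorem dirD_sum {ι : Type*} {s : Finset ι} {f : ι → E → F} {x : E}
    (hf : ∀ i ∈ s, DifferentiableAt ℝ (f i) x) (w : E) :
    dirD w (fun y => ∑ i ∈ s, f i y) x = ∑ i ∈ s, dirD w (f i) x := by
  simp [dirD, fderiv_fun_sum hf]

theorem dirD_comm {f : E → F} {x : E} (hf : ContDiffAt ℝ ∞ f x) (u v : E) :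
    dirD u (dirD v f) x = dirD v (dirD u f) x := by
  have h := differentiableAt_of_smooth (hf.fderiv_right (m := ∞) (by simp))
  have hs := hf.isSymmSndFDerivAt (by simp; exact ENat.LEInfty.out) u v
  unfold dirD
  rw [fderiv_clm_apply h (differentiableAt_const v),
    fderiv_clm_apply h (differentiableAt_const u)]
  simpa using hs

/-- The derivative of `D_{a(y)} f (y)` for a direction `a` varying with the point. -/
theorem dirD_dirD_var {f : E → F} {a : E → E} {x : E} (hf : ContDiffAt ℝ ∞ f x)
    (ha : DifferentiableAt ℝ a x) (w : E) :
    dirD w (fun y => dirD (a y) f y) x = dirD w (dirD (a x) f) x + dirD (dirD w a x) f x := by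
  have h := differentiableAt_of_smooth (hf.fderiv_right (m := ∞) (by simp))
  unfold dirD
  rw [fderiv_clm_apply h ha, fderiv_clm_apply h (differentiableAt_const _)]
  simp [add_comm]

theorem dirD_lin_apply {L : E → E₁ →L[ℝ] F} {a : E → E₁} {x : E}
    (hL : DifferentiableAt ℝ L x) (ha : DifferentiableAt ℝ a x) (w : E) :
    dirD w (fun y => L y (a y)) x = dirD w L x (a x) + L x (dirD w a x) := by
  unfold dirD
  rw [fderiv_clm_apply hL ha]
  simp [add_comm]

theorem dirD_bilin_apply {B : E → E₁ →L[ℝ] E₂ →L[ℝ] F} {a : E → E₁} {b : E → E₂} {x : E}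
    (hB : DifferentiableAt ℝ B x) (ha : DifferentiableAt ℝ a x) (hb : DifferentiableAt ℝ b x)
    (w : E) :
    dirD w (fun y => B y (a y) (b y)) x
      = dirD w B x (a x) (b x) + B x (dirD w a x) (b x) + B x (a x) (dirD w b x) := by
  rw [dirD_lin_apply (L := fun y => B y (a y)) (hB.clm_apply ha) hb, dirD_lin_apply hB ha]
  simp

theorem dirD_bilin_const {B : E → E₁ →L[ℝ] E₂ →L[ℝ] F} {x : E}
    (hB : DifferentiableAt ℝ B x) (a : E₁) (b : E₂) (w : E) :
    dirD w (fun y => B y a b) x = dirD w B x a b := by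
  rw [dirD_bilin_apply hB (differentiableAt_const a) (differentiableAt_const b)]
  simp [dirD_const]

end Calculus

/-! ### The curvature of a Levi-Civita connection -/

section Curvature

variable {E : Type*} [NormedAddCommGroup E] [NormedSpace ℝ E]

/-- The curvature endomorphism `w ↦ R(u, v) w` of the connection `∇_u Y = D_u Y + Γ(u, Y)`, for
fixed `u` and `v`. -/
def curv (Γ : E → E →L[ℝ] E →L[ℝ] E) (x u v : E) : E →L[ℝ] E :=
  dirD u Γ x v - dirD v Γ x u + ((Γ x u).comp (Γ x v) - (Γ x v).comp (Γ x u))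

theorem curv_apply (Γ : E → E →L[ℝ] E →L[ℝ] E) (x u v w : E) :
    curv Γ x u v w = dirD u Γ x v w - dirD v Γ x u w
      + (Γ x u (Γ x v w) - Γ x v (Γ x u w)) := by
  simp [curv]

theorem curv_swap (Γ : E → E →L[ℝ] E →L[ℝ] E) (x u v w : E) :
    curv Γ x u v w = - curv Γ x v u w := by
  simp only [curv_apply]; abel

theorem curv_add_left (Γ : E → E →L[ℝ] E →L[ℝ] E) (x u u' v w : E) :
    curv Γ x (u + u') v w = curv Γ x u v w + curv Γ x u' v w := by
  simp only [curv_apply, dirD_add_dir, map_add, add_apply]; abel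

theorem curv_smul_left (Γ : E → E →L[ℝ] E →L[ℝ] E) (c : ℝ) (x u v w : E) :
    curv Γ x (c • u) v w = c • curv Γ x u v w := by
  simp only [curv_apply, dirD_smul_dir, map_smul, smul_apply, smul_add, smul_sub]

/-- `Γ` is the Christoffel map of the Levi-Civita connection of the metric `g` on the open set
`U`: smooth, torsion free and metric. -/
structure IsLeviCivitaOn (g : E → E →L[ℝ] E →L[ℝ] ℝ) (Γ : E → E →L[ℝ] E →L[ℝ] E) (U : Set E) :
    Prop where
  isOpen : IsOpen U
  smooth_metric : ∀ x ∈ U, ContDiffAt ℝ ∞ g x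
  smooth_conn : ∀ x ∈ U, ContDiffAt ℝ ∞ Γ x
  metric_symm : ∀ x ∈ U, ∀ u v, g x u v = g x v u
  metric_nondeg : ∀ x ∈ U, ∀ u, (∀ v, g x u v = 0) → u = 0
  conn_symm : ∀ x ∈ U, ∀ u v, Γ x u v = Γ x v u
  compat : ∀ x ∈ U, ∀ w u v, dirD w g x u v = g x (Γ x w u) v + g x u (Γ x w v)

namespace IsLeviCivitaOn

variable {g : E → E →L[ℝ] E →L[ℝ] ℝ} {Γ : E → E →L[ℝ] E →L[ℝ] E} {U : Set E} {x : E}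

theorem eventually (h : IsLeviCivitaOn g Γ U) (hx : x ∈ U) : ∀ᶠ y in nhds x, y ∈ U :=
  h.isOpen.mem_nhds hx

theorem ext_metric (h : IsLeviCivitaOn g Γ U) (hx : x ∈ U) {u v : E}
    (huv : ∀ z, g x u z = g x v z) : u = v := by
  rw [← sub_eq_zero]
  exact h.metric_nondeg x hx _ fun z => by simp [huv z]

theorem dirD_conn_symm (h : IsLeviCivitaOn g Γ U) (hx : x ∈ U) (z u v : E) :
    dirD z Γ x u v = dirD z Γ x v u := by
  have hd := differentiableAt_of_smooth (h.smooth_conn x hx)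
  rw [← dirD_bilin_const hd, ← dirD_bilin_const hd]
  exact dirD_congr ((h.eventually hx).mono fun y hy => h.conn_symm y hy u v) z

/-- The first Bianchi identity. -/
theorem bianchi (h : IsLeviCivitaOn g Γ U) (hx : x ∈ U) (u v w : E) :
    curv Γ x u v w + curv Γ x v w u + curv Γ x w u v = 0 := by
  simp only [curv_apply, h.dirD_conn_symm hx u w v, h.dirD_conn_symm hx v w u,
    h.dirD_conn_symm hx w v u, h.conn_symm x hx w u, h.conn_symm x hx w v, h.conn_symm x hx v u]
  abel

theorem dirD_dirD_metric (h : IsLeviCivitaOn g Γ U) (hx : x ∈ U) (z w u v : E) :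
    dirD z (dirD w g) x u v =
      g x (Γ x z (Γ x w u)) v + g x (Γ x w u) (Γ x z v) + g x (dirD z Γ x w u) v
      + (g x (Γ x z u) (Γ x w v) + g x u (Γ x z (Γ x w v)) + g x u (dirD z Γ x w v)) := by
  have hg := differentiableAt_of_smooth (h.smooth_metric x hx)
  have hg' := differentiableAt_of_smooth (contDiffAt_dirD (h.smooth_metric x hx) w)
  have hΓ := differentiableAt_of_smooth (h.smooth_conn x hx)
  have hΓw : ∀ a, DifferentiableAt ℝ (fun y => Γ y w a) x := fun a =>
    (hΓ.clm_apply (differentiableAt_const w)).clm_apply (differentiableAt_const a)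
  have hc : ∀ a : E, DifferentiableAt ℝ (fun _ : E => a) x := fun a => differentiableAt_const a
  rw [← dirD_bilin_const hg',
    dirD_congr ((h.eventually hx).mono fun y hy => h.compat y hy w u v) z,
    dirD_add ((hg.clm_apply (hΓw u)).clm_apply (hc v)) ((hg.clm_apply (hc u)).clm_apply (hΓw v)),
    dirD_bilin_apply hg (hΓw u) (hc v), dirD_bilin_apply hg (hc u) (hΓw v),
    dirD_bilin_const hΓ, dirD_bilin_const hΓ]
  simp only [dirD_const, h.compat x hx, map_zero, add_zero, zero_apply]

/-- The curvature of the Levi-Civita connection is skew with respect to the metric. -/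
theorem curv_skew (h : IsLeviCivitaOn g Γ U) (hx : x ∈ U) (z w u v : E) :
    g x (curv Γ x z w u) v + g x u (curv Γ x z w v) = 0 := by
  have e : dirD z (dirD w g) x u v = dirD w (dirD z g) x u v := by
    rw [dirD_comm (h.smooth_metric x hx)]
  rw [h.dirD_dirD_metric hx, h.dirD_dirD_metric hx] at e
  simp only [curv_apply, map_add, map_sub, add_apply, sub_apply]
  linarith

end IsLeviCivitaOn

end Curvature

/-! ### The Lie derivative of a connection -/

section LieDerivative

variable {E : Type*} [NormedAddCommGroup E] [NormedSpace ℝ E]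

theorem dirD_curv {Γ : E → E →L[ℝ] E →L[ℝ] E} {x : E} (hΓ : ContDiffAt ℝ ∞ Γ x) (z w u v : E) :
    dirD z (fun y => curv Γ y w u v) x =
      dirD z (dirD w Γ) x u v - dirD z (dirD u Γ) x w v
      + (dirD z Γ x w (Γ x u v) + Γ x w (dirD z Γ x u v)
        - (dirD z Γ x u (Γ x w v) + Γ x u (dirD z Γ x w v))) := by
  have hd := differentiableAt_of_smooth hΓ
  have hd' := fun a => differentiableAt_of_smooth (contDiffAt_dirD hΓ a)
  have hc : ∀ a : E, DifferentiableAt ℝ (fun _ : E => a) x := fun a => differentiableAt_const a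
  have h1 : ∀ a b, DifferentiableAt ℝ (fun y => Γ y a b) x := fun a b =>
    (hd.clm_apply (hc a)).clm_apply (hc b)
  have h2 : ∀ a b c, DifferentiableAt ℝ (fun y => dirD a Γ y b c) x := fun a b c =>
    ((hd' a).clm_apply (hc b)).clm_apply (hc c)
  have h3 : ∀ a b c, DifferentiableAt ℝ (fun y => Γ y a (Γ y b c)) x := fun a b c =>
    (hd.clm_apply (hc a)).clm_apply (h1 b c)
  simp only [curv_apply]
  rw [dirD_add ((h2 _ _ _).fun_sub (h2 _ _ _)) ((h3 _ _ _).fun_sub (h3 _ _ _)),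
    dirD_sub (h2 _ _ _) (h2 _ _ _), dirD_sub (h3 _ _ _) (h3 _ _ _), dirD_bilin_const (hd' _),
    dirD_bilin_const (hd' _), dirD_bilin_apply hd (hc _) (h1 _ _),
    dirD_bilin_apply hd (hc _) (h1 _ _), dirD_bilin_const hd, dirD_bilin_const hd]
  simp only [dirD_const, map_zero, zero_apply, add_zero]

/-- The Lie derivative `(L_ξ Γ)(u, v)` of a connection. Although `Γ` is not a tensor, the
variation of `Γ` along the flow of `ξ` is one; the second derivative of `ξ` compensates for the
inhomogeneous term in the transformation law of `Γ`. -/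
def lieConn (Γ : E → E →L[ℝ] E →L[ℝ] E) (ξ : E → E) (x u v : E) : E :=
  dirD u (dirD v ξ) x + dirD (ξ x) Γ x u v + Γ x (dirD u ξ x) v + Γ x u (dirD v ξ x)
    - dirD (Γ x u v) ξ x

/-- The covariant derivative `(∇_w T)(u, v)` of a vector valued bilinear form. -/
def covVec (Γ : E → E →L[ℝ] E →L[ℝ] E) (T : E → E → E → E) (x w u v : E) : E :=
  dirD w (fun y => T y u v) x + Γ x w (T x u v) - T x (Γ x w u) v - T x u (Γ x w v)

theorem dirD_lieConn {Γ : E → E →L[ℝ] E →L[ℝ] E} {ξ : E → E} {x : E}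
    (hΓ : ContDiffAt ℝ ∞ Γ x) (hξ : ContDiffAt ℝ ∞ ξ x) (w u v : E) :
    dirD w (fun y => lieConn Γ ξ y u v) x =
      dirD w (dirD u (dirD v ξ)) x
      + (dirD w (dirD (ξ x) Γ) x u v + dirD (dirD w ξ x) Γ x u v)
      + (dirD w Γ x (dirD u ξ x) v + Γ x (dirD w (dirD u ξ) x) v)
      + (dirD w Γ x u (dirD v ξ x) + Γ x u (dirD w (dirD v ξ) x))
      - (dirD w (dirD (Γ x u v) ξ) x + dirD (dirD w Γ x u v) ξ x) := by
  have hd := differentiableAt_of_smooth hΓ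
  have hdξ := differentiableAt_of_smooth hξ
  have hd' := fun a => differentiableAt_of_smooth (contDiffAt_dirD hξ a)
  have hd2 := fun a b =>
    differentiableAt_of_smooth (contDiffAt_dirD (contDiffAt_dirD hξ b) a)
  have hc : ∀ a : E, DifferentiableAt ℝ (fun _ : E => a) x := fun a => differentiableAt_const a
  have hDΓ : DifferentiableAt ℝ (fun y => dirD (ξ y) Γ y) x :=
    (differentiableAt_of_smooth (hΓ.fderiv_right (m := ∞) (by simp))).clm_apply hdξ
  have hΓuv : DifferentiableAt ℝ (fun y => Γ y u v) x := (hd.clm_apply (hc u)).clm_apply (hc v)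
  have hDξ : DifferentiableAt ℝ (fun y => dirD (Γ y u v) ξ y) x :=
    (differentiableAt_of_smooth (hξ.fderiv_right (m := ∞) (by simp))).clm_apply hΓuv
  have t2 : DifferentiableAt ℝ (fun y => dirD (ξ y) Γ y u v) x :=
    (hDΓ.clm_apply (hc u)).clm_apply (hc v)
  have t3 : DifferentiableAt ℝ (fun y => Γ y (dirD u ξ y) v) x :=
    (hd.clm_apply (hd' u)).clm_apply (hc v)
  have t4 : DifferentiableAt ℝ (fun y => Γ y u (dirD v ξ y)) x :=
    (hd.clm_apply (hc u)).clm_apply (hd' v)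
  simp only [lieConn]
  rw [dirD_sub ((((hd2 u v).fun_add t2).fun_add t3).fun_add t4) hDξ,
    dirD_add (((hd2 u v).fun_add t2).fun_add t3) t4, dirD_add ((hd2 u v).fun_add t2) t3,
    dirD_add (hd2 u v) t2, dirD_bilin_const hDΓ, dirD_dirD_var hΓ hdξ,
    dirD_bilin_apply hd (hd' u) (hc v), dirD_bilin_apply hd (hc u) (hd' v),
    dirD_dirD_var hξ hΓuv, dirD_bilin_const hd]
  simp only [dirD_const, map_zero, zero_apply, add_zero, add_apply]

/-- The Lie derivative of the curvature is the skew part of the covariant derivative of the Lie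
derivative of the connection. -/
theorem lie_curv {Γ : E → E →L[ℝ] E →L[ℝ] E} {ξ : E → E} {x : E}
    (hΓ : ContDiffAt ℝ ∞ Γ x) (hs : ∀ u v, Γ x u v = Γ x v u)
    (hξ : ContDiffAt ℝ ∞ ξ x) (w u v : E) :
    dirD (ξ x) (fun y => curv Γ y w u v) x - dirD (curv Γ x w u v) ξ x
      + curv Γ x (dirD w ξ x) u v + curv Γ x w (dirD u ξ x) v + curv Γ x w u (dirD v ξ x)
      = covVec Γ (lieConn Γ ξ) x w u v - covVec Γ (lieConn Γ ξ) x u w v := by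
  have e1 : dirD w (dirD u (dirD v ξ)) x = dirD u (dirD w (dirD v ξ)) x :=
    dirD_comm (contDiffAt_dirD hξ v) w u
  have e4 : ∀ a b, dirD (Γ x a b) (dirD v ξ) x = dirD v (dirD (Γ x a b) ξ) x :=
    fun a b => dirD_comm hξ _ _
  rw [covVec, covVec, dirD_lieConn hΓ hξ, dirD_lieConn hΓ hξ, dirD_curv hΓ]
  simp only [lieConn, curv_apply, map_add, map_sub, dirD_add_dir,
    dirD_sub_dir]
  rw [dirD_comm hΓ (ξ x) w, dirD_comm hΓ (ξ x) u, e1, dirD_comm hξ u w, hs u w]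
  simp only [e4]
  abel

end LieDerivative

/-! ### Conformal vector fields -/

section Conformal

variable {E : Type*} [NormedAddCommGroup E] [NormedSpace ℝ E]

/-- `ξ` is a smooth conformal vector field of the metric `g` on `U` with smooth characteristic
function `f`: `L_ξ g = 2 f g`. -/
structure IsConformalOn (g : E → E →L[ℝ] E →L[ℝ] ℝ) (ξ : E → E) (f : E → ℝ) (U : Set E) :
    Prop where
  smooth_field : ∀ x ∈ U, ContDiffAt ℝ ∞ ξ x
  smooth_char : ∀ x ∈ U, ContDiffAt ℝ ∞ f x
  lie_eq : ∀ x ∈ U, ∀ u v, dirD (ξ x) g x u v + g x (dirD u ξ x) v + g x u (dirD v ξ x)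
    = 2 * f x * g x u v

/-- The Hessian `Hess f (u, v)` with respect to the connection `Γ`. -/
def hessian (Γ : E → E →L[ℝ] E →L[ℝ] E) (f : E → ℝ) (x u v : E) : ℝ :=
  dirD u (dirD v f) x - dirD (Γ x u v) f x

/-- The covariant derivative `∇_w Y` of a vector field. -/
def covField (Γ : E → E →L[ℝ] E →L[ℝ] E) (Y : E → E) (x w : E) : E :=
  dirD w Y x + Γ x w (Y x)

theorem lieConn_symm {Γ : E → E →L[ℝ] E →L[ℝ] E} {ξ : E → E} {x : E}
    (hξ : ContDiffAt ℝ ∞ ξ x) (hs : ∀ u v, Γ x u v = Γ x v u)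
    (hs' : ∀ z u v, dirD z Γ x u v = dirD z Γ x v u) (u v : E) :
    lieConn Γ ξ x u v = lieConn Γ ξ x v u := by
  simp only [lieConn]
  rw [dirD_comm hξ u v, hs' _ u v, hs _ v, hs u, hs u v]
  abel

variable {g : E → E →L[ℝ] E →L[ℝ] ℝ} {Γ : E → E →L[ℝ] E →L[ℝ] E} {U : Set E} {x : E}
  {ξ : E → E} {f : E → ℝ}

namespace IsLeviCivitaOn

theorem hessian_symm (h : IsLeviCivitaOn g Γ U) (hx : x ∈ U) (hf : ContDiffAt ℝ ∞ f x) (u v : E) :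
    hessian Γ f x u v = hessian Γ f x v u := by
  rw [hessian, hessian, dirD_comm hf, h.conn_symm x hx]

/-- The Lie derivative along `ξ` of the equation `∇ g = 0`: differentiating `L_ξ g = 2 f g` and
using that `L_ξ` commutes with `D` leaves only the variation of the connection. -/
theorem metric_lieConn (h : IsLeviCivitaOn g Γ U) (hc : IsConformalOn g ξ f U) (hx : x ∈ U)
    (w u v : E) :
    g x (lieConn Γ ξ x w u) v + g x u (lieConn Γ ξ x w v) = 2 * dirD w f x * g x u v := by
  have hg := differentiableAt_of_smooth (h.smooth_metric x hx)
  have hξ := differentiableAt_of_smooth (hc.smooth_field x hx)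
  have hDξ := fun a =>
    differentiableAt_of_smooth (contDiffAt_dirD (hc.smooth_field x hx) a)
  have hf := differentiableAt_of_smooth (hc.smooth_char x hx)
  have hk : ∀ a : E, DifferentiableAt ℝ (fun _ : E => a) x := fun a => differentiableAt_const a
  have hDg : DifferentiableAt ℝ (fun y => dirD (ξ y) g y) x :=
    (differentiableAt_of_smooth ((h.smooth_metric x hx).fderiv_right (m := ∞) (by simp))).clm_apply
      hξ
  have t1 : DifferentiableAt ℝ (fun y => dirD (ξ y) g y u v) x :=
    (hDg.clm_apply (hk u)).clm_apply (hk v)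
  have t2 : DifferentiableAt ℝ (fun y => g y (dirD u ξ y) v) x :=
    (hg.clm_apply (hDξ u)).clm_apply (hk v)
  have t3 : DifferentiableAt ℝ (fun y => g y u (dirD v ξ y)) x :=
    (hg.clm_apply (hk u)).clm_apply (hDξ v)
  have t4 : DifferentiableAt ℝ (fun y => g y u v) x := (hg.clm_apply (hk u)).clm_apply (hk v)
  have key := dirD_congr ((h.eventually hx).mono fun y hy => hc.lie_eq y hy u v) w
  rw [dirD_add (t1.fun_add t2) t3, dirD_add t1 t2, dirD_bilin_const hDg,
    dirD_dirD_var (h.smooth_metric x hx) hξ, dirD_bilin_apply hg (hDξ u) (hk v),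
    dirD_bilin_apply hg (hk u) (hDξ v), dirD_mul (hf.const_mul 2) t4, dirD_bilin_const hg,
    dirD_comm (h.smooth_metric x hx)] at key
  have e : dirD w (fun y => 2 * f y) x = 2 * dirD w f x := by
    rw [dirD_mul (differentiableAt_const _) hf, dirD_const]; ring
  have l1 := hc.lie_eq x hx (Γ x w u) v
  have l2 := hc.lie_eq x hx u (Γ x w v)
  simp only [e, dirD_const, add_apply, map_zero, zero_apply, h.dirD_dirD_metric hx,
    h.compat x hx] at key l1 l2
  simp only [lieConn, map_add, map_sub, add_apply, sub_apply]
  linear_combination key - l1 - l2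

/-- The Lie derivative of the Levi-Civita connection along a conformal field:
`(L_ξ Γ)(u, v) = df(u) v + df(v) u - g(u, v) grad f`. -/
theorem lieConn_eq (h : IsLeviCivitaOn g Γ U) (hc : IsConformalOn g ξ f U) (hx : x ∈ U) {N : E}
    (hN : ∀ z, g x N z = dirD z f x) (u v : E) :
    lieConn Γ ξ x u v = dirD u f x • v + dirD v f x • u - g x u v • N := by
  refine h.ext_metric hx fun z => ?_
  have hs := lieConn_symm (hc.smooth_field x hx) (h.conn_symm x hx)
    (fun z u v => h.dirD_conn_symm hx z u v)
  -- The Koszul trick: a symmetric `T` is determined by `g(T(w, u), v) + g(u, T(w, v))`.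
  have k1 := h.metric_lieConn hc hx u v z
  have k2 := h.metric_lieConn hc hx v u z
  have k3 := h.metric_lieConn hc hx z u v
  rw [hs v u] at k2
  rw [hs z u, hs z v, h.metric_symm x hx _ v] at k3
  simp only [map_add, map_sub, map_smul, add_apply, sub_apply, smul_apply, smul_eq_mul, hN]
  linarith

/-- The covariant derivative of `L_ξ Γ` along a conformal field, where `N` is the gradient of the
characteristic function. -/
theorem covVec_lieConn (h : IsLeviCivitaOn g Γ U) (hc : IsConformalOn g ξ f U) (hx : x ∈ U)
    {N : E → E} (hNs : DifferentiableAt ℝ N x) (hN : ∀ y ∈ U, ∀ z, g y (N y) z = dirD z f y)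
    (w u v : E) :
    covVec Γ (lieConn Γ ξ) x w u v
      = hessian Γ f x w u • v + hessian Γ f x w v • u - g x u v • covField Γ N x w := by
  have hg := differentiableAt_of_smooth (h.smooth_metric x hx)
  have hDf := fun a =>
    differentiableAt_of_smooth (contDiffAt_dirD (hc.smooth_char x hx) a)
  have hk : ∀ a : E, DifferentiableAt ℝ (fun _ : E => a) x := fun a => differentiableAt_const a
  have t4 : DifferentiableAt ℝ (fun y => g y u v) x := (hg.clm_apply (hk u)).clm_apply (hk v)
  have e := dirD_congr
    ((h.eventually hx).mono fun y hy => h.lieConn_eq hc hy (hN y hy) u v) w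
  rw [dirD_sub (((hDf u).fun_smul (hk v)).fun_add ((hDf v).fun_smul (hk u))) (t4.fun_smul hNs),
    dirD_add ((hDf u).fun_smul (hk v)) ((hDf v).fun_smul (hk u)), dirD_smul (hDf u) (hk v),
    dirD_smul (hDf v) (hk u), dirD_smul t4 hNs, dirD_bilin_const hg] at e
  rw [covVec, e]
  simp only [h.lieConn_eq hc hx (hN x hx), hessian, covField, dirD_const, h.compat x hx,
    map_add, map_sub, map_smul]
  module

end IsLeviCivitaOn

/-- The second covariant derivative of a vector field and the Lie derivative of the connection
differ by a curvature term: `∇²_{u,v} ξ = (L_ξ Γ)(u, v) + R(u, ξ) v`. -/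
theorem dirD_covField (hΓ : ContDiffAt ℝ ∞ Γ x) (hs : ∀ u v, Γ x u v = Γ x v u)
    (hs' : ∀ z u v, dirD z Γ x u v = dirD z Γ x v u) (hξ : ContDiffAt ℝ ∞ ξ x) (u v : E) :
    dirD u (fun y => covField Γ ξ y v) x + Γ x u (covField Γ ξ x v) - covField Γ ξ x (Γ x u v)
      = lieConn Γ ξ x u v + curv Γ x u (ξ x) v := by
  have hd := differentiableAt_of_smooth hΓ
  have hdξ := differentiableAt_of_smooth hξ
  have hk : ∀ a : E, DifferentiableAt ℝ (fun _ : E => a) x := fun a => differentiableAt_const a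
  have hD := differentiableAt_of_smooth (contDiffAt_dirD hξ v)
  simp only [covField]
  rw [dirD_add hD ((hd.clm_apply (hk v)).clm_apply hdξ), dirD_bilin_apply hd (hk v) hdξ,
    lieConn, curv_apply, hs' u v, hs v (dirD u ξ x), hs v (ξ x), hs (Γ x u v)]
  simp only [dirD_const, map_add, map_zero, zero_apply]
  abel

end Conformal

/-! ### Traces and the Ricci tensor -/

section Ricci

variable {n : ℕ}

/-- The `i`-th vector of the standard basis of coordinate space. -/
abbrev stdVec (i : Fin n) : Coord n := EuclideanSpace.single i 1

theorem stdVec_apply (i j : Fin n) : (stdVec i : Coord n) j = if j = i then 1 else 0 := by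
  simp [stdVec]

theorem sum_smul_stdVec (v : Coord n) : ∑ i, v i • stdVec i = v := by
  ext j
  simp [Pi.single_apply]

theorem sum_smul_apply_stdVec {F : Type*} [AddCommGroup F] [Module ℝ F] {α : Coord n → F}
    (hα : IsLinearMap ℝ α) (v : Coord n) : ∑ i, v i • α (stdVec i) = α v := by
  conv_rhs => rw [← sum_smul_stdVec v]
  exact ((map_sum hα.mk' _ _).trans (Finset.sum_congr rfl fun i _ => hα.map_smul _ _)).symm

theorem sum_mul_apply_stdVec {α : Coord n → ℝ} (hα : IsLinearMap ℝ α) (v : Coord n) :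
    ∑ i, α (stdVec i) * v i = α v := by
  rw [← sum_smul_apply_stdVec hα v]
  exact Finset.sum_congr rfl fun i _ => mul_comm _ _

theorem isLinearMap_apply_left {E F : Type*} [NormedAddCommGroup E] [NormedSpace ℝ E]
    [NormedAddCommGroup F] [NormedSpace ℝ F] (b : E →L[ℝ] E →L[ℝ] F) (v : E) :
    IsLinearMap ℝ fun u => b u v where
  map_add u u' := by simp
  map_smul c u := by simp

theorem trace_eq_sum (L : Coord n →ₗ[ℝ] Coord n) :
    LinearMap.trace ℝ (Coord n) L = ∑ i, L (stdVec i) i := by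
  rw [LinearMap.trace_eq_matrix_trace ℝ (EuclideanSpace.basisFun (Fin n) ℝ).toBasis, Matrix.trace]
  simp [LinearMap.toMatrix_apply]

theorem dirD_apply {E : Type*} [NormedAddCommGroup E] [NormedSpace ℝ E] {Y : E → Coord n} {x : E}
    (hY : DifferentiableAt ℝ Y x) (z : E) (i : Fin n) :
    dirD z (fun y => Y y i) x = dirD z Y x i := by
  have := ((EuclideanSpace.proj i : Coord n →L[ℝ] ℝ).hasFDerivAt.comp x hY.hasFDerivAt).fderiv
  have h2 := congrArg (fun L => L z) this
  simpa [dirD, Function.comp_def] using h2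

theorem contDiffAt_curv {E : Type*} [NormedAddCommGroup E] [NormedSpace ℝ E]
    {Γ : E → E →L[ℝ] E →L[ℝ] E} {x : E} (hΓ : ContDiffAt ℝ ∞ Γ x) (u v : E) :
    ContDiffAt ℝ ∞ (fun y => curv Γ y u v) x := by
  have h1 : ∀ a, ContDiffAt ℝ ∞ (fun y => Γ y a) x := fun a => hΓ.clm_apply contDiffAt_const
  have h2 : ∀ a b, ContDiffAt ℝ ∞ (fun y => dirD a Γ y b) x := fun a b =>
    (contDiffAt_dirD hΓ a).clm_apply contDiffAt_const
  exact ((h2 u v).sub (h2 v u)).add (((h1 u).clm_comp (h1 v)).sub ((h1 v).clm_comp (h1 u)))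

/-- The Ricci tensor `Ric(u, v)`, the trace of `w ↦ R(w, u) v`. -/
def ric (Γ : Coord n → Coord n →L[ℝ] Coord n →L[ℝ] Coord n) (x u v : Coord n) : ℝ :=
  ∑ i, curv Γ x (stdVec i) u v i

/-- The endomorphism `w ↦ R(w, u) v`. -/
def curvEnd {E : Type*} [NormedAddCommGroup E] [NormedSpace ℝ E]
    (Γ : E → E →L[ℝ] E →L[ℝ] E) (x u v : E) : E →ₗ[ℝ] E where
  toFun w := curv Γ x w u v
  map_add' w w' := curv_add_left Γ x w w' u v
  map_smul' c w := curv_smul_left Γ c x w u v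

variable {g : Coord n → Coord n →L[ℝ] Coord n →L[ℝ] ℝ}
  {Γ : Coord n → Coord n →L[ℝ] Coord n →L[ℝ] Coord n} {U : Set (Coord n)} {x : Coord n}
  {ξ : Coord n → Coord n} {f : Coord n → ℝ}

theorem isLinearMap_ric_left (x v : Coord n) : IsLinearMap ℝ fun u => ric Γ x u v where
  map_add u u' := by
    simp only [ric, ← Finset.sum_add_distrib]
    refine Finset.sum_congr rfl fun i _ => ?_
    rw [curv_swap, curv_add_left, curv_swap Γ x u, curv_swap Γ x u', neg_add, neg_neg, neg_neg]
    rfl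
  map_smul c u := by
    simp only [ric, smul_eq_mul, Finset.mul_sum]
    refine Finset.sum_congr rfl fun i _ => ?_
    rw [curv_swap, curv_smul_left, curv_swap Γ x u, smul_neg, neg_neg]
    rfl

theorem isLinearMap_ric_right (x u : Coord n) : IsLinearMap ℝ fun v => ric Γ x u v where
  map_add v v' := by simp [ric, Finset.sum_add_distrib]
  map_smul c v := by simp [ric, Finset.mul_sum]

/-- The matrix `K` is inverse to the Gram matrix of the bilinear form `b`. -/
def IsInverseGram (b : Coord n →L[ℝ] Coord n →L[ℝ] ℝ) (K : Matrix (Fin n) (Fin n) ℝ) : Prop :=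
  ∀ v k, ∑ j, K k j * b (stdVec j) v = v k

/-- The trace of an endomorphism, computed by raising an index. -/
theorem sum_sum_comm_apply {b : Coord n →L[ℝ] Coord n →L[ℝ] ℝ} {K : Matrix (Fin n) (Fin n) ℝ}
    (hK : IsInverseGram b K) (L : Coord n → Coord n) :
    ∑ k, ∑ j, K k j * b (stdVec j) (L (stdVec k)) = ∑ k, L (stdVec k) k :=
  Finset.sum_congr rfl fun k _ => hK _ k

theorem IsInverseGram.symm {b : Coord n →L[ℝ] Coord n →L[ℝ] ℝ} {K : Matrix (Fin n) (Fin n) ℝ}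
    (hK : IsInverseGram b K) (hb : ∀ u v, b u v = b v u) (k l : Fin n) : K k l = K l k := by
  have e : ∀ k v, b (∑ j, K k j • stdVec j) v = v k := fun k v => by
    simpa using hK v k
  have e2 : ∀ k l, (∑ j, K k j • stdVec j : Coord n) l = K k l := fun k l => by
    simp [Pi.single_apply]
  rw [← e2 k l, ← e l, hb, e k, e2]

/-- The trace of an endomorphism that is skew for a nondegenerate symmetric form vanishes. -/
theorem sum_skew_eq_zero {b : Coord n →L[ℝ] Coord n →L[ℝ] ℝ} {K : Matrix (Fin n) (Fin n) ℝ}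
    (hK : IsInverseGram b K) (hb : ∀ u v, b u v = b v u) {L : Coord n → Coord n}
    (hL : ∀ u v, b (L u) v + b u (L v) = 0) : ∑ k, L (stdVec k) k = 0 := by
  -- Written with `K`, the trace of `L` is minus the trace of the adjoint of `L`, hence of `L`.
  have e : ∑ k, L (stdVec k) k = - ∑ k, L (stdVec k) k := by
    conv_lhs => rw [← sum_sum_comm_apply hK, Finset.sum_comm]
    rw [← sum_sum_comm_apply hK, ← Finset.sum_neg_distrib]
    refine Finset.sum_congr rfl fun k _ => ?_
    rw [← Finset.sum_neg_distrib]
    refine Finset.sum_congr rfl fun j _ => ?_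
    rw [hK.symm hb j k, hb (stdVec j), eq_neg_of_add_eq_zero_right (hL (stdVec k) (stdVec j))]
    ring
  linarith

namespace IsLeviCivitaOn

theorem ric_symm (h : IsLeviCivitaOn g Γ U) (hx : x ∈ U) {K : Matrix (Fin n) (Fin n) ℝ}
    (hK : IsInverseGram (g x) K) (u v : Coord n) : ric Γ x u v = ric Γ x v u := by
  -- By the first Bianchi identity the skew part of `Ric` is the trace of `w ↦ R(u, v) w`.
  have e := sum_skew_eq_zero hK (h.metric_symm x hx) (fun a b => h.curv_skew hx u v a b)
  rw [← sub_eq_zero, ric, ric, ← Finset.sum_sub_distrib, ← neg_eq_zero, ← e,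
    ← Finset.sum_neg_distrib]
  refine Finset.sum_congr rfl fun i _ => ?_
  have b := congrArg (fun z : Coord n => z i) (h.bianchi hx u v (stdVec i))
  rw [curv_swap Γ x v (stdVec i)] at b
  simp at b
  linarith

/-- The covariant derivative of the gradient represents the Hessian. -/
theorem metric_covField_grad (h : IsLeviCivitaOn g Γ U) (hx : x ∈ U)
    {N : Coord n → Coord n} (hNs : DifferentiableAt ℝ N x)
    (hN : ∀ y ∈ U, ∀ z, g y (N y) z = dirD z f y) (u v : Coord n) :
    g x (covField Γ N x u) v = hessian Γ f x u v := by
  have hg := differentiableAt_of_smooth (h.smooth_metric x hx)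
  have e := dirD_congr ((h.eventually hx).mono fun y hy => hN y hy v) u
  rw [dirD_bilin_apply hg hNs (differentiableAt_const v)] at e
  simp only [dirD_const, map_zero, add_zero, h.compat x hx] at e
  have e' : dirD u (fun y => dirD v f y) x = dirD u (dirD v f) x := rfl
  rw [hessian, covField, map_add, add_apply, ← hN x hx (Γ x u v), ← e', ← e]
  ring

end IsLeviCivitaOn

theorem isLinearMap_hessian (x v : Coord n) : IsLinearMap ℝ fun u => hessian Γ f x u v where
  map_add u u' := by simp only [hessian, dirD_add_dir, map_add, add_apply]; ring
  map_smul c u := by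
    simp only [hessian, dirD_smul_dir, map_smul, smul_apply, smul_eq_mul]; ring

/-- The Lie derivative of the Ricci tensor along a conformal field:
`L_ξ Ric = - (n - 2) Hess f - (Δ f) g`, with `Δ f` the trace of the covariant derivative of the
gradient `N`. -/
theorem IsLeviCivitaOn.lie_ric (h : IsLeviCivitaOn g Γ U) (hc : IsConformalOn g ξ f U) (hx : x ∈ U)
    {N : Coord n → Coord n} (hNs : DifferentiableAt ℝ N x)
    (hN : ∀ y ∈ U, ∀ z, g y (N y) z = dirD z f y) (u v : Coord n) :
    dirD (ξ x) (fun y => ric Γ y u v) x + ric Γ x (dirD u ξ x) v + ric Γ x u (dirD v ξ x)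
      = - ((n : ℝ) - 2) * hessian Γ f x u v
        - (∑ i, covField Γ N x (stdVec i) i) * g x u v := by
  have hΓ := h.smooth_conn x hx
  have hξ := hc.smooth_field x hx
  have hf := hc.smooth_char x hx
  have hcurv : ∀ w, DifferentiableAt ℝ (fun y => curv Γ y w u v) x := fun w =>
    differentiableAt_of_smooth ((contDiffAt_curv hΓ w u).clm_apply contDiffAt_const)
  have e0 : dirD (ξ x) (fun y => ric Γ y u v) x
      = ∑ i, dirD (ξ x) (fun y => curv Γ y (stdVec i) u v) x i := by
    simp only [ric]
    rw [dirD_sum (f := fun i y => curv Γ y (stdVec i) u v i) fun i _ =>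
      ((EuclideanSpace.proj i : Coord n →L[ℝ] ℝ).differentiableAt).comp x (hcurv (stdVec i))]
    exact Finset.sum_congr rfl fun i _ => dirD_apply (hcurv _) _ i
  -- `L_ξ R` contains the commutator of `Dξ` with `w ↦ R(w, u) v`, whose trace vanishes.
  have ecomm : ∑ i, dirD (curv Γ x (stdVec i) u v) ξ x i
      = ∑ i, curv Γ x (dirD (stdVec i) ξ x) u v i := by
    have := LinearMap.trace_mul_comm ℝ (fderiv ℝ ξ x : Coord n →ₗ[ℝ] Coord n) (curvEnd Γ x u v)
    rwa [trace_eq_sum, trace_eq_sum] at this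
  have key : ∀ i, _ := fun i =>
    congrArg (fun z : Coord n => z i) (lie_curv hΓ (h.conn_symm x hx) hξ (stdVec i) u v)
  simp only [h.covVec_lieConn hc hx hNs hN] at key
  simp only [PiLp.add_apply, PiLp.sub_apply, PiLp.smul_apply, smul_eq_mul] at key
  have hsum := Finset.sum_congr (rfl : (Finset.univ : Finset (Fin n)) = Finset.univ)
    fun i _ => key i
  simp only [Finset.sum_add_distrib, Finset.sum_sub_distrib] at hsum
  have s1 := sum_mul_apply_stdVec (isLinearMap_hessian (Γ := Γ) (f := f) x u) v
  have s2 := sum_mul_apply_stdVec (isLinearMap_hessian (Γ := Γ) (f := f) x v) u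
  have s3 : ∑ i, hessian Γ f x u (stdVec i) * v i = hessian Γ f x u v := by
    simp only [h.hessian_symm hx hf u]
    exact s1
  have s4 : ∑ i : Fin n, hessian Γ f x u v * (stdVec i : Coord n) i = n * hessian Γ f x u v := by
    simp
  have s5 : ∑ i, g x (stdVec i) v * covField Γ N x u i = hessian Γ f x u v := by
    rw [sum_mul_apply_stdVec (isLinearMap_apply_left (g x) _),
      h.metric_covField_grad hx hNs hN]
  rw [s1, s2, s3, s4, s5, ← Finset.mul_sum, h.hessian_symm hx hf v u, ecomm, ← e0] at hsum
  simp only [ric] at hsum ⊢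
  linarith

/-- The divergence of the second covariant derivative of a conformal field. -/
theorem IsLeviCivitaOn.sum_lieConn_add_curv (h : IsLeviCivitaOn g Γ U)
    (hc : IsConformalOn g ξ f U) (hx : x ∈ U) {N : Coord n} (hN : ∀ z, g x N z = dirD z f x)
    (v : Coord n) :
    ∑ i, (lieConn Γ ξ x (stdVec i) v + curv Γ x (stdVec i) (ξ x) v) i
      = n * dirD v f x + ric Γ x (ξ x) v := by
  have s1 : ∑ i, dirD (stdVec i) f x * v i = dirD v f x :=
    sum_mul_apply_stdVec ⟨fun a b => dirD_add_dir a b f x, fun c a => dirD_smul_dir c a f x⟩ v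
  have s2 : ∑ i, g x (stdVec i) v * N i = dirD v f x := by
    rw [sum_mul_apply_stdVec (isLinearMap_apply_left (g x) _), hN]
  simp only [h.lieConn_eq hc hx hN, PiLp.add_apply, PiLp.sub_apply, PiLp.smul_apply, smul_eq_mul,
    Finset.sum_add_distrib, Finset.sum_sub_distrib, s1, s2, ric]
  simp

end Ricci

/-! ### From components to bilinear maps -/

section Components

variable {n : ℕ}

theorem ext_stdVec {F : Type*} [AddCommGroup F] [Module ℝ F] {α β : Coord n → F}
    (hα : IsLinearMap ℝ α) (hβ : IsLinearMap ℝ β) (h : ∀ i, α (stdVec i) = β (stdVec i))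
    (v : Coord n) : α v = β v := by
  rw [← sum_smul_apply_stdVec hα, ← sum_smul_apply_stdVec hβ]
  simp only [h]

theorem isLinearMap_clm {E F : Type*} [NormedAddCommGroup E] [NormedSpace ℝ E]
    [NormedAddCommGroup F] [NormedSpace ℝ F] (b : E →L[ℝ] F) : IsLinearMap ℝ fun u => b u :=
  b.toLinearMap.isLinear

theorem isLinearMap_dirD {E F : Type*} [NormedAddCommGroup E] [NormedSpace ℝ E]
    [NormedAddCommGroup F] [NormedSpace ℝ F] (f : E → F) (x : E) :
    IsLinearMap ℝ fun u => dirD u f x :=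
  isLinearMap_clm (fderiv ℝ f x)

theorem contDiffAt_smul_const {E F : Type*} [NormedAddCommGroup E] [NormedSpace ℝ E]
    [NormedAddCommGroup F] [NormedSpace ℝ F] {c : E → ℝ} {x : E} (hc : ContDiffAt ℝ ∞ c x) (v : F) :
    ContDiffAt ℝ ∞ (fun y => c y • v) x :=
  hc.smul contDiffAt_const

/-- The bilinear form with components `T i j`. -/
def bilForm (T : Fin n → Fin n → ℝ) : Coord n →L[ℝ] Coord n →L[ℝ] ℝ :=
  ∑ i, ∑ j, T i j • (EuclideanSpace.proj i : Coord n →L[ℝ] ℝ).smulRight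
    (EuclideanSpace.proj j : Coord n →L[ℝ] ℝ)

theorem bilForm_apply (T : Fin n → Fin n → ℝ) (u v : Coord n) :
    bilForm T u v = ∑ i, ∑ j, T i j * (u i * v j) := by
  simp [bilForm]

theorem bilForm_stdVec (T : Fin n → Fin n → ℝ) (i j : Fin n) :
    bilForm T (stdVec i) (stdVec j) = T i j := by
  simp [bilForm_apply]

theorem contDiffAt_bilForm {T : Fin n → Fin n → Coord n → ℝ} {x : Coord n}
    (hT : ∀ i j, ContDiffAt ℝ ∞ (T i j) x) :
    ContDiffAt ℝ ∞ (fun y => bilForm fun i j => T i j y) x :=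
  ContDiffAt.sum fun i _ => ContDiffAt.sum fun j _ => contDiffAt_smul_const (hT i j) _

theorem bilForm_eq (b : Coord n →L[ℝ] Coord n →L[ℝ] ℝ) {T : Fin n → Fin n → ℝ}
    (h : ∀ i j, T i j = b (stdVec i) (stdVec j)) : bilForm T = b := by
  refine ContinuousLinearMap.ext fun u => ContinuousLinearMap.ext fun v => ?_
  refine ext_stdVec (isLinearMap_apply_left _ v) (isLinearMap_apply_left _ v) (fun i => ?_) u
  refine ext_stdVec (isLinearMap_clm _) (isLinearMap_clm _) (fun j => ?_) v
  rw [bilForm_stdVec, h]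

/-- The metric with coefficient matrix `G`, as a field of bilinear forms. -/
def metricForm (G : Coord n → Matrix (Fin n) (Fin n) ℝ) (x : Coord n) :
    Coord n →L[ℝ] Coord n →L[ℝ] ℝ :=
  bilForm fun i j => G x i j

/-- The Christoffel symbols of `G` as a field of vector valued bilinear maps. -/
def connMap (G : Coord n → Matrix (Fin n) (Fin n) ℝ) (x : Coord n) :
    Coord n →L[ℝ] Coord n →L[ℝ] Coord n :=
  ∑ k, ∑ i, ∑ j, christoffel G k i j x • (EuclideanSpace.proj i : Coord n →L[ℝ] ℝ).smulRight
    ((EuclideanSpace.proj j : Coord n →L[ℝ] ℝ).smulRight (stdVec k : Coord n))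

theorem connMap_stdVec (G : Coord n → Matrix (Fin n) (Fin n) ℝ) (x : Coord n) (k i j : Fin n) :
    connMap G x (stdVec i) (stdVec j) k = christoffel G k i j x := by
  simp only [connMap, sum_apply, smul_apply, ContinuousLinearMap.smulRight_apply]
  simp [Pi.single_apply]

theorem pd_eq_dirD (i : Fin n) (u : Coord n → ℝ) (x : Coord n) :
    pd i u x = dirD (stdVec i) u x := rfl

theorem contDiffAt_pd {u : Coord n → ℝ} {x : Coord n} (hu : ContDiffAt ℝ ∞ u x) (i : Fin n) :
    ContDiffAt ℝ ∞ (pd i u) x :=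
  contDiffAt_dirD hu _

/-- `G` is the coefficient matrix of a smooth pseudo-Riemannian metric on the open set `U`. -/
structure IsMetricOn (G : Coord n → Matrix (Fin n) (Fin n) ℝ) (U : Set (Coord n)) : Prop where
  isOpen : IsOpen U
  smooth : ∀ x ∈ U, ∀ i j, ContDiffAt ℝ ∞ (fun y => G y i j) x
  symm : ∀ x ∈ U, ∀ i j, G x i j = G x j i
  isUnit_det : ∀ x ∈ U, IsUnit (G x).det

theorem contDiffAt_det {E : Type*} [NormedAddCommGroup E] [NormedSpace ℝ E]
    {A : E → Matrix (Fin n) (Fin n) ℝ} {x : E}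
    (hA : ∀ i j, ContDiffAt ℝ ∞ (fun y => A y i j) x) :
    ContDiffAt ℝ ∞ (fun y => (A y).det) x := by
  simp only [Matrix.det_apply']
  exact ContDiffAt.sum fun σ _ => contDiffAt_const.mul (contDiffAt_prod fun i _ => hA _ _)

namespace IsMetricOn

variable {G : Coord n → Matrix (Fin n) (Fin n) ℝ} {U : Set (Coord n)} {x : Coord n}

theorem contDiffAt_gInv (h : IsMetricOn G U) (hx : x ∈ U) (i j : Fin n) :
    ContDiffAt ℝ ∞ (gInv G i j) x := by
  -- By the formula for the inverse in terms of cofactors.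
  have e : gInv G i j = fun y => (G y).det⁻¹ * ((G y).updateRow j (Pi.single i 1)).det := by
    funext y
    rw [gInv, Matrix.inv_def, Matrix.smul_apply, Matrix.adjugate_apply, Ring.inverse_eq_inv',
      smul_eq_mul]
  rw [e]
  refine ((contDiffAt_det (h.smooth x hx)).inv (h.isUnit_det x hx).ne_zero).mul
    (contDiffAt_det fun a b => ?_)
  by_cases hab : a = j
  · subst hab
    simpa using contDiffAt_const
  · simpa [Matrix.updateRow_ne hab] using h.smooth x hx a b

theorem contDiffAt_christoffel (h : IsMetricOn G U) (hx : x ∈ U) (k i j : Fin n) :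
    ContDiffAt ℝ ∞ (christoffel G k i j) x :=
  contDiffAt_const.mul (ContDiffAt.sum fun l _ => (h.contDiffAt_gInv hx k l).mul
    (((contDiffAt_pd (h.smooth x hx _ _) _).add (contDiffAt_pd (h.smooth x hx _ _) _)).sub
      (contDiffAt_pd (h.smooth x hx _ _) _)))

theorem contDiffAt_metricForm (h : IsMetricOn G U) (hx : x ∈ U) :
    ContDiffAt ℝ ∞ (metricForm G) x :=
  contDiffAt_bilForm (T := fun i j y => G y i j) (h.smooth x hx)

theorem contDiffAt_connMap (h : IsMetricOn G U) (hx : x ∈ U) :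
    ContDiffAt ℝ ∞ (connMap G) x :=
  ContDiffAt.sum fun k _ => ContDiffAt.sum fun i _ => ContDiffAt.sum fun j _ =>
    contDiffAt_smul_const (h.contDiffAt_christoffel hx k i j) _

theorem pd_symm (h : IsMetricOn G U) (hx : x ∈ U) (k i j : Fin n) :
    pd k (fun y => G y i j) x = pd k (fun y => G y j i) x :=
  dirD_congr (Filter.mem_of_superset (h.isOpen.mem_nhds hx) fun y hy => h.symm y hy i j) _

theorem metricForm_symm (h : IsMetricOn G U) (hx : x ∈ U) (u v : Coord n) :
    metricForm G x u v = metricForm G x v u := by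
  rw [metricForm, bilForm_apply, bilForm_apply, Finset.sum_comm]
  exact Finset.sum_congr rfl fun i _ => Finset.sum_congr rfl fun j _ => by
    rw [h.symm x hx, mul_comm (u _)]

theorem sum_gInv_mul (h : IsMetricOn G U) (hx : x ∈ U) (k l : Fin n) :
    ∑ j, gInv G k j x * G x j l = if k = l then 1 else 0 := by
  have := congrFun (congrFun (Matrix.nonsing_inv_mul (G x) (h.isUnit_det x hx)) k) l
  rwa [Matrix.mul_apply, Matrix.one_apply] at this

theorem isInverseGram (h : IsMetricOn G U) (hx : x ∈ U) :
    IsInverseGram (metricForm G x) (fun i j => gInv G i j x) := by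
  intro v k
  refine ext_stdVec (α := fun v => ∑ j, gInv G k j x * metricForm G x (stdVec j) v)
    (β := fun v : Coord n => v k)
    ⟨fun a b => by simp [mul_add, Finset.sum_add_distrib], fun c a => by
      simp only [map_smul, smul_eq_mul, Finset.mul_sum]
      exact Finset.sum_congr rfl fun i _ => by ring⟩
    ⟨fun a b => rfl, fun c a => rfl⟩ (fun i => ?_) v
  simp only [metricForm, bilForm_stdVec]
  rw [h.sum_gInv_mul hx, stdVec_apply]

theorem dirD_metricForm (h : IsMetricOn G U) (hx : x ∈ U) (k i j : Fin n) :
    dirD (stdVec k) (metricForm G) x (stdVec i) (stdVec j) = pd k (fun y => G y i j) x := by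
  rw [← dirD_bilin_const (differentiableAt_of_smooth (h.contDiffAt_metricForm hx))]
  simp only [metricForm, bilForm_stdVec]
  rfl

/-- The Koszul formula for coordinate vector fields. -/
theorem metricForm_connMap (h : IsMetricOn G U) (hx : x ∈ U) (i j k : Fin n) :
    metricForm G x (connMap G x (stdVec i) (stdVec j)) (stdVec k) =
      (1 / 2) * (pd i (fun y => G y j k) x + pd j (fun y => G y i k) x
        - pd k (fun y => G y i j) x) := by
  rw [← sum_smul_apply_stdVec (isLinearMap_apply_left (metricForm G x) (stdVec k))]
  simp only [connMap_stdVec, metricForm, bilForm_stdVec, smul_eq_mul, christoffel]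
  have e : ∀ l, ∑ m, G x m k * gInv G m l x = if l = k then 1 else 0 := fun l => by
    rw [← h.sum_gInv_mul hx l k]
    refine Finset.sum_congr rfl fun m _ => ?_
    rw [mul_comm, (h.isInverseGram hx).symm (h.metricForm_symm hx) m l]
  simp only [mul_assoc, Finset.sum_mul, ← Finset.mul_sum]
  rw [Finset.sum_comm]
  congr 1
  have : ∀ l, ∑ m, gInv G m l x * ((pd i (fun y => G y j l) x + pd j (fun y => G y i l) x
      - pd l (fun y => G y i j) x) * G x m k) = (if l = k then 1 else 0) *
      (pd i (fun y => G y j l) x + pd j (fun y => G y i l) x - pd l (fun y => G y i j) x) := by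
    intro l
    rw [← e l, Finset.sum_mul]
    exact Finset.sum_congr rfl fun m _ => by ring
  simp only [this]
  simp

/-- The Christoffel symbols of a metric define its Levi-Civita connection. -/
theorem isLeviCivitaOn (h : IsMetricOn G U) : IsLeviCivitaOn (metricForm G) (connMap G) U where
  isOpen := h.isOpen
  smooth_metric _ hx := h.contDiffAt_metricForm hx
  smooth_conn _ hx := h.contDiffAt_connMap hx
  metric_symm _ hx := h.metricForm_symm hx
  metric_nondeg x hx u hu := by
    ext k
    rw [← h.isInverseGram hx u k]
    simp [h.metricForm_symm hx _ u, hu]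
  conn_symm x hx u v := by
    refine ext_stdVec (β := fun u => connMap G x v u) (isLinearMap_apply_left _ v)
      (isLinearMap_clm _) (fun i => ?_) u
    refine ext_stdVec (α := fun v => connMap G x (stdVec i) v)
      (isLinearMap_clm _) (isLinearMap_apply_left _ _) (fun j => ?_) v
    ext k
    rw [connMap_stdVec, connMap_stdVec, christoffel, christoffel]
    simp only [h.pd_symm hx _ j i]
    congr 1
    exact Finset.sum_congr rfl fun l _ => by ring
  compat x hx w u v := by
    have l1 : ∀ v w, IsLinearMap ℝ fun u =>
        metricForm G x (connMap G x w u) v + metricForm G x u (connMap G x w v) := fun v w =>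
      ⟨fun a b => by simp only [map_add, add_apply]; ring,
        fun c a => by simp only [map_smul, smul_apply, smul_eq_mul]; ring⟩
    have l2 : ∀ u w, IsLinearMap ℝ fun v =>
        metricForm G x (connMap G x w u) v + metricForm G x u (connMap G x w v) := fun v w =>
      ⟨fun a b => by simp only [map_add]; ring,
        fun c a => by simp only [map_smul, smul_eq_mul]; ring⟩
    have l3 : IsLinearMap ℝ fun w =>
        metricForm G x (connMap G x w u) v + metricForm G x u (connMap G x w v) :=
      ⟨fun a b => by simp only [map_add, add_apply]; ring,
        fun c a => by simp only [map_smul, smul_apply, smul_eq_mul]; ring⟩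
    refine ext_stdVec (α := fun w => dirD w (metricForm G) x u v)
      ⟨fun a b => by simp [dirD_add_dir], fun c a => by simp [dirD_smul_dir]⟩ l3 (fun k => ?_) w
    refine ext_stdVec (isLinearMap_apply_left _ v) (l1 v _) (fun i => ?_) u
    refine ext_stdVec (isLinearMap_clm _) (l2 _ _) (fun j => ?_) v
    rw [h.metricForm_symm hx (stdVec i), h.metricForm_connMap hx, h.metricForm_connMap hx,
      h.dirD_metricForm hx, h.pd_symm hx k j i]
    ring

end IsMetricOn

end Components

/-! ### Curvature quantities in components -/

section LocalIdentity

variable {n : ℕ}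

/-- The vector field with components `X i`. -/
def vecField (X : Fin n → Coord n → ℝ) (y : Coord n) : Coord n :=
  WithLp.toLp 2 fun i => X i y

theorem vecField_apply (X : Fin n → Coord n → ℝ) (y : Coord n) (i : Fin n) :
    vecField X y i = X i y := rfl

theorem contDiffAt_vecField {X : Fin n → Coord n → ℝ} {x : Coord n}
    (hX : ∀ i, ContDiffAt ℝ ∞ (X i) x) : ContDiffAt ℝ ∞ (vecField X) x := by
  rw [contDiffAt_euclidean]
  exact hX

theorem dirD_vecField {X : Fin n → Coord n → ℝ} {x : Coord n}
    (hX : ∀ i, ContDiffAt ℝ ∞ (X i) x) (w : Coord n) (i : Fin n) :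
    dirD w (vecField X) x i = dirD w (X i) x :=
  (dirD_apply (differentiableAt_of_smooth (contDiffAt_vecField hX)) w i).symm

theorem metricForm_stdVec (G : Coord n → Matrix (Fin n) (Fin n) ℝ) (x : Coord n) (i j : Fin n) :
    metricForm G x (stdVec i) (stdVec j) = G x i j :=
  bilForm_stdVec _ i j

theorem sum_components_right {F : Type*} [NormedAddCommGroup F] [NormedSpace ℝ F]
    (a : Coord n →L[ℝ] F) (v : Coord n) : ∑ i, v i • a (stdVec i) = a v :=
  sum_smul_apply_stdVec (isLinearMap_clm a) v

theorem flat_eq (G : Coord n → Matrix (Fin n) (Fin n) ℝ) (X : Fin n → Coord n → ℝ) (i : Fin n)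
    (y : Coord n) : flat G X i y = metricForm G y (stdVec i) (vecField X y) := by
  rw [← sum_components_right, flat]
  simp only [metricForm_stdVec, vecField_apply, smul_eq_mul, mul_comm]

/-- The covariant derivative of a covector field whose value at `x` is the linear form `a`. -/
theorem covDeriv₁_eq (G : Coord n → Matrix (Fin n) (Fin n) ℝ) {α : Fin n → Coord n → ℝ}
    {x : Coord n} {a : Coord n → ℝ} (ha : IsLinearMap ℝ a) (hα : ∀ i, α i x = a (stdVec i))
    (i j : Fin n) :
    covDeriv₁ G α i j x = dirD (stdVec j) (α i) x - a (connMap G x (stdVec j) (stdVec i)) := by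
  rw [← sum_smul_apply_stdVec ha, covDeriv₁]
  simp only [connMap_stdVec, hα, smul_eq_mul]
  rfl

/-- The covariant derivative of a `(0,2)`-tensor whose value at `x` is the bilinear form `b`. -/
theorem covDeriv₂_eq (G : Coord n → Matrix (Fin n) (Fin n) ℝ) {T : Fin n → Fin n → Coord n → ℝ}
    {x : Coord n} {b : Coord n → Coord n → ℝ} (hl : ∀ v, IsLinearMap ℝ fun u => b u v)
    (hr : ∀ u, IsLinearMap ℝ fun v => b u v) (hT : ∀ i j, T i j x = b (stdVec i) (stdVec j))
    (i j k : Fin n) :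
    covDeriv₂ G T i j k x = dirD (stdVec k) (T i j) x
      - b (connMap G x (stdVec k) (stdVec i)) (stdVec j)
      - b (stdVec i) (connMap G x (stdVec k) (stdVec j)) := by
  rw [← sum_smul_apply_stdVec (hl _), ← sum_smul_apply_stdVec (hr _), covDeriv₂]
  simp only [connMap_stdVec, hT, smul_eq_mul]
  rfl

theorem riemann_eq {G : Coord n → Matrix (Fin n) (Fin n) ℝ} {x : Coord n}
    (hΓ : ContDiffAt ℝ ∞ (connMap G) x) (l i j k : Fin n) :
    riemann G l i j k x = curv (connMap G) x (stdVec j) (stdVec k) (stdVec i) l := by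
  have hd := differentiableAt_of_smooth hΓ
  have e : ∀ a b c d, pd a (christoffel G d b c) x
      = dirD (stdVec a) (connMap G) x (stdVec b) (stdVec c) d := fun a b c d => by
    have hbc : DifferentiableAt ℝ (fun y => connMap G y (stdVec b) (stdVec c)) x :=
      (hd.clm_apply (differentiableAt_const _)).clm_apply (differentiableAt_const _)
    rw [← dirD_bilin_const hd, ← dirD_apply hbc]
    simp only [connMap_stdVec]
    rfl
  have q : ∀ a v, connMap G x (stdVec a) v l = ∑ m, christoffel G l a m x * v m := fun a v => by
    have := sum_smul_apply_stdVec (α := fun v => connMap G x (stdVec a) v l)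
      ⟨fun u v => by simp, fun c v => by simp⟩ v
    rw [← this]
    simp only [connMap_stdVec, smul_eq_mul, mul_comm]
  rw [curv_apply, riemann, e, e, Finset.sum_sub_distrib]
  simp only [PiLp.add_apply, PiLp.sub_apply, q, connMap_stdVec]

variable {G : Coord n → Matrix (Fin n) (Fin n) ℝ} {U : Set (Coord n)} {x : Coord n}

/-- The Ricci tensor as a field of bilinear forms. -/
def ricForm (Γ : Coord n → Coord n →L[ℝ] Coord n →L[ℝ] Coord n) (x : Coord n) :
    Coord n →L[ℝ] Coord n →L[ℝ] ℝ :=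
  bilForm fun i j => ric Γ x (stdVec i) (stdVec j)

theorem ricForm_apply (Γ : Coord n → Coord n →L[ℝ] Coord n →L[ℝ] Coord n) (x u v : Coord n) :
    ricForm Γ x u v = ric Γ x u v := by
  refine ext_stdVec (isLinearMap_apply_left _ v) (isLinearMap_ric_left x v) (fun i => ?_) u
  refine ext_stdVec (isLinearMap_clm _) (isLinearMap_ric_right x _) (fun j => ?_) v
  rw [ricForm, bilForm_stdVec]

theorem contDiffAt_ric {Γ : Coord n → Coord n →L[ℝ] Coord n →L[ℝ] Coord n} {x : Coord n}
    (hΓ : ContDiffAt ℝ ∞ Γ x) (u v : Coord n) : ContDiffAt ℝ ∞ (fun y => ric Γ y u v) x :=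
  ContDiffAt.sum fun i _ =>
    contDiffAt_euclidean.1 ((contDiffAt_curv hΓ (stdVec i) u).clm_apply contDiffAt_const) i

theorem contDiffAt_ricForm {Γ : Coord n → Coord n →L[ℝ] Coord n →L[ℝ] Coord n} {x : Coord n}
    (hΓ : ContDiffAt ℝ ∞ Γ x) : ContDiffAt ℝ ∞ (ricForm Γ) x :=
  contDiffAt_bilForm (T := fun i j y => ric Γ y (stdVec i) (stdVec j))
    fun _ _ => contDiffAt_ric hΓ _ _

namespace IsMetricOn

theorem ricForm_symm (h : IsMetricOn G U) (hx : x ∈ U) (u v : Coord n) :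
    ricForm (connMap G) x u v = ricForm (connMap G) x v u := by
  rw [ricForm_apply, ricForm_apply, h.isLeviCivitaOn.ric_symm hx (h.isInverseGram hx)]

theorem gInv_symm (h : IsMetricOn G U) (hx : x ∈ U) (i j : Fin n) :
    gInv G i j x = gInv G j i x :=
  (h.isInverseGram hx).symm (h.metricForm_symm hx) i j

/-- The index definition of the Ricci tensor contracts the other pair of indices; skewness of the
curvature operators identifies it with the trace of `w ↦ R(w, u) v`. -/
theorem ricci_eq (h : IsMetricOn G U) (hx : x ∈ U) (i j : Fin n) :
    ricci G i j x = ricForm (connMap G) x (stdVec i) (stdVec j) := by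
  have hL := h.isLeviCivitaOn
  rw [h.ricForm_symm hx, ricForm_apply, ric]
  simp only [curv_swap (connMap G) x _ (stdVec j), PiLp.neg_apply]
  rw [Finset.sum_neg_distrib, ← sum_sum_comm_apply (h.isInverseGram hx)
    (fun w => curv (connMap G) x (stdVec j) w (stdVec i)), Finset.sum_comm, ricci,
    ← Finset.sum_neg_distrib]
  refine Finset.sum_congr rfl fun k _ => ?_
  rw [← Finset.sum_neg_distrib]
  refine Finset.sum_congr rfl fun l _ => ?_
  have e : riemannLow G i k j l x = metricForm G x (stdVec i)
      (curv (connMap G) x (stdVec j) (stdVec l) (stdVec k)) := by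
    rw [← sum_components_right, riemannLow]
    refine Finset.sum_congr rfl fun s _ => ?_
    rw [riemann_eq (h.contDiffAt_connMap hx), metricForm_stdVec, smul_eq_mul, mul_comm]
  have s := hL.curv_skew hx (stdVec j) (stdVec l) (stdVec i) (stdVec k)
  rw [e, h.gInv_symm hx k l, h.metricForm_symm hx (stdVec k)]
  linear_combination gInv G l k x * s

theorem contDiffAt_ricci (h : IsMetricOn G U) (hx : x ∈ U) (i j : Fin n) :
    ContDiffAt ℝ ∞ (ricci G i j) x := by
  refine (contDiffAt_ric (h.contDiffAt_connMap hx) (stdVec i) (stdVec j)).congr_of_eventuallyEq ?_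
  filter_upwards [h.isOpen.mem_nhds hx] with y hy
  rw [h.ricci_eq hy, ricForm_apply]

theorem contDiffAt_scalarCurv (h : IsMetricOn G U) (hx : x ∈ U) :
    ContDiffAt ℝ ∞ (scalarCurv G) x :=
  ContDiffAt.sum fun _ _ => ContDiffAt.sum fun _ _ =>
    (h.contDiffAt_gInv hx _ _).mul (h.contDiffAt_ricci hx _ _)

end IsMetricOn

theorem hess_eq (G : Coord n → Matrix (Fin n) (Fin n) ℝ) (f : Coord n → ℝ) (x : Coord n)
    (i j : Fin n) : hess G f i j x = hessian (connMap G) f x (stdVec i) (stdVec j) := by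
  rw [hess, hessian, ← sum_smul_apply_stdVec (isLinearMap_dirD f x)]
  simp only [connMap_stdVec, smul_eq_mul]
  rfl

/-- The gradient of `f`. -/
def grad (G : Coord n → Matrix (Fin n) (Fin n) ℝ) (f : Coord n → ℝ) : Coord n → Coord n :=
  vecField fun k y => ∑ l, gInv G k l y * pd l f y

namespace IsMetricOn

theorem contDiffAt_grad (h : IsMetricOn G U) (hx : x ∈ U) {f : Coord n → ℝ}
    (hf : ContDiffAt ℝ ∞ f x) : ContDiffAt ℝ ∞ (grad G f) x :=
  contDiffAt_vecField fun _ => ContDiffAt.sum fun _ _ =>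
    (h.contDiffAt_gInv hx _ _).mul (contDiffAt_pd hf _)

theorem metricForm_grad (h : IsMetricOn G U) (hx : x ∈ U) (f : Coord n → ℝ) (z : Coord n) :
    metricForm G x (grad G f x) z = dirD z f x := by
  refine ext_stdVec (isLinearMap_clm _) (isLinearMap_dirD f x) (fun i => ?_) z
  rw [h.metricForm_symm hx, ← sum_components_right]
  simp only [metricForm_stdVec, grad, vecField_apply, smul_eq_mul, Finset.sum_mul]
  rw [Finset.sum_comm]
  have e : ∀ l, ∑ k, gInv G k l x * pd l f x * G x i k = (if l = i then 1 else 0) * pd l f x :=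
    fun l => by
      rw [← h.sum_gInv_mul hx l i, Finset.sum_mul]
      refine Finset.sum_congr rfl fun k _ => ?_
      rw [h.gInv_symm hx k l, h.symm x hx i k]; ring
  simp only [e]
  simp [pd_eq_dirD]

/-- The Laplacian is the trace of the covariant derivative of the gradient. -/
theorem laplacian_eq (h : IsMetricOn G U) (hx : x ∈ U) {f : Coord n → ℝ}
    (hf : ContDiffAt ℝ ∞ f x) :
    laplacian G f x = ∑ i, covField (connMap G) (grad G f) x (stdVec i) i := by
  have hN := differentiableAt_of_smooth (h.contDiffAt_grad hx hf)
  rw [← sum_sum_comm_apply (h.isInverseGram hx), laplacian]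
  refine Finset.sum_congr rfl fun i _ => Finset.sum_congr rfl fun j _ => ?_
  rw [h.metricForm_symm hx (stdVec j), h.isLeviCivitaOn.metric_covField_grad hx hN
    (fun y hy => h.metricForm_grad hy f), hess_eq]

/-- In components: `ξ` is a conformal field with characteristic function `f`. -/
theorem isConformalOn (h : IsMetricOn G U) {X : Fin n → Coord n → ℝ} {f : Coord n → ℝ}
    (hX : ∀ x ∈ U, ∀ i, ContDiffAt ℝ ∞ (X i) x) (hf : ∀ x ∈ U, ContDiffAt ℝ ∞ f x)
    (hl : ∀ x ∈ U, ∀ i j, lieDerivMetric G X i j x = 2 * f x * G x i j) :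
    IsConformalOn (metricForm G) (vecField X) f U where
  smooth_field x hx := contDiffAt_vecField (hX x hx)
  smooth_char := hf
  lie_eq x hx u v := by
    have l1 : ∀ v, IsLinearMap ℝ fun u => dirD (vecField X x) (metricForm G) x u v
        + metricForm G x (dirD u (vecField X) x) v + metricForm G x u (dirD v (vecField X) x) :=
      fun v => ⟨fun a b => by simp only [map_add, add_apply, dirD_add_dir]; ring,
        fun c a => by simp only [map_smul, smul_apply, smul_eq_mul, dirD_smul_dir]; ring⟩
    have l2 : ∀ u, IsLinearMap ℝ fun v => dirD (vecField X x) (metricForm G) x u v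
        + metricForm G x (dirD u (vecField X) x) v + metricForm G x u (dirD v (vecField X) x) :=
      fun v => ⟨fun a b => by simp only [map_add, dirD_add_dir]; ring,
        fun c a => by simp only [map_smul, smul_eq_mul, dirD_smul_dir]; ring⟩
    have r1 : ∀ v, IsLinearMap ℝ fun u => 2 * f x * metricForm G x u v :=
      fun v => ⟨fun a b => by simp only [map_add, add_apply]; ring,
        fun c a => by simp only [map_smul, smul_apply, smul_eq_mul]; ring⟩
    have r2 : ∀ u, IsLinearMap ℝ fun v => 2 * f x * metricForm G x u v :=
      fun v => ⟨fun a b => by simp only [map_add]; ring,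
        fun c a => by simp only [map_smul, smul_eq_mul]; ring⟩
    refine ext_stdVec (l1 v) (r1 v) (fun i => ?_) u
    refine ext_stdVec (l2 _) (r2 _) (fun j => ?_) v
    rw [metricForm_stdVec, ← hl x hx, lieDerivMetric, Finset.sum_add_distrib,
      Finset.sum_add_distrib,
      ← sum_components_right (metricForm G x (stdVec i)) (dirD (stdVec j) (vecField X) x),
      h.metricForm_symm hx _ (stdVec j),
      ← sum_components_right (metricForm G x (stdVec j)) (dirD (stdVec i) (vecField X) x),
      ← sum_smul_apply_stdVec (α := fun w => dirD w (metricForm G) x (stdVec i) (stdVec j))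
        ⟨fun a b => by simp [dirD_add_dir], fun c a => by simp [dirD_smul_dir]⟩ (vecField X x)]
    simp only [h.dirD_metricForm hx, metricForm_stdVec, dirD_vecField (hX x hx), vecField_apply,
      smul_eq_mul]
    congr 1
    · congr 1
      refine Finset.sum_congr rfl fun k _ => ?_
      rw [h.symm x hx k j, pd_eq_dirD, mul_comm]
    · exact Finset.sum_congr rfl fun k _ => mul_comm _ _

end IsMetricOn

end LocalIdentity

/-! ### The identity in a coordinate domain -/

section ConformalIdentity

variable {n : ℕ}

theorem isLinearMap_covField {E : Type*} [NormedAddCommGroup E] [NormedSpace ℝ E]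
    (Γ : E → E →L[ℝ] E →L[ℝ] E) (Y : E → E) (x : E) : IsLinearMap ℝ fun w => covField Γ Y x w where
  map_add u v := by simp only [covField, dirD_add_dir, map_add, add_apply]; abel
  map_smul c u := by simp only [covField, dirD_smul_dir, map_smul, smul_apply, smul_add]

/-- For a conformal field, the symmetric part of `∇ξ` is `f` times the identity. -/
theorem IsLeviCivitaOn.metric_covField {E : Type*} [NormedAddCommGroup E] [NormedSpace ℝ E]
    {g : E → E →L[ℝ] E →L[ℝ] ℝ} {Γ : E → E →L[ℝ] E →L[ℝ] E} {U : Set E} {x : E}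
    {ξ : E → E} {f : E → ℝ} (h : IsLeviCivitaOn g Γ U) (hc : IsConformalOn g ξ f U) (hx : x ∈ U)
    (u v : E) :
    g x (covField Γ ξ x u) v + g x u (covField Γ ξ x v) = 2 * f x * g x u v := by
  rw [← hc.lie_eq x hx, h.compat x hx]
  simp only [covField, map_add, add_apply, h.conn_symm x hx (ξ x)]
  ring

/-- The covariant derivative `(∇_w Ric)(u, v)`. -/
def covRic (Γ : Coord n → Coord n →L[ℝ] Coord n →L[ℝ] Coord n) (x w u v : Coord n) : ℝ :=
  dirD w (ricForm Γ) x u v - ricForm Γ x (Γ x w u) v - ricForm Γ x u (Γ x w v)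

theorem isLinearMap_covRic (Γ : Coord n → Coord n →L[ℝ] Coord n →L[ℝ] Coord n) (x u v : Coord n) :
    IsLinearMap ℝ fun w => covRic Γ x w u v where
  map_add a b := by simp only [covRic, dirD_add_dir, map_add, add_apply]; ring
  map_smul c a := by
    simp only [covRic, dirD_smul_dir, map_smul, smul_apply, smul_eq_mul]; ring

theorem isLinearMap_covRic_right (Γ : Coord n → Coord n →L[ℝ] Coord n →L[ℝ] Coord n)
    (x w u : Coord n) : IsLinearMap ℝ fun v => covRic Γ x w u v where
  map_add a b := by simp only [covRic, map_add]; ring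
  map_smul c a := by simp only [covRic, map_smul, smul_eq_mul]; ring

variable {G : Coord n → Matrix (Fin n) (Fin n) ℝ} {U : Set (Coord n)} {x : Coord n}
  {X : Fin n → Coord n → ℝ} {f : Coord n → ℝ}

namespace IsMetricOn

theorem covDeriv₁_flat (h : IsMetricOn G U) (hx : x ∈ U) (hX : ∀ i, ContDiffAt ℝ ∞ (X i) x)
    (j k : Fin n) : covDeriv₁ G (flat G X) j k x
      = metricForm G x (stdVec j) (covField (connMap G) (vecField X) x (stdVec k)) := by
  have hg := differentiableAt_of_smooth (h.contDiffAt_metricForm hx)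
  have hξ := differentiableAt_of_smooth (contDiffAt_vecField hX)
  rw [covDeriv₁_eq G (isLinearMap_apply_left (metricForm G x) (vecField X x))
    (fun i => flat_eq G X i x), funext (flat_eq G X j),
    dirD_bilin_apply hg (differentiableAt_const _) hξ, h.isLeviCivitaOn.compat x hx, covField]
  simp only [dirD_const, map_add, map_zero, zero_apply]
  ring

theorem skewPart_eq (h : IsMetricOn G U) (hc : IsConformalOn (metricForm G) (vecField X) f U)
    (hx : x ∈ U) (hX : ∀ i, ContDiffAt ℝ ∞ (X i) x) (j k : Fin n) :
    skewPart G X j k x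
      = metricForm G x (stdVec j) (covField (connMap G) (vecField X) x (stdVec k))
        - f x * metricForm G x (stdVec j) (stdVec k) := by
  have e := h.isLeviCivitaOn.metric_covField hc hx (stdVec j) (stdVec k)
  rw [h.metricForm_symm hx _ (stdVec k)] at e
  rw [skewPart, h.covDeriv₁_flat hx hX, h.covDeriv₁_flat hx hX]
  linarith

/-- The covariant derivative of the skew part of a conformal field:
`(∇_w P)(u, v) = g(u, L_ξ Γ (w, v) + R(w, ξ) v) - df(w) g(u, v)`. -/
theorem covDeriv₂_skewPart (h : IsMetricOn G U)
    (hc : IsConformalOn (metricForm G) (vecField X) f U) (hX : ∀ x ∈ U, ∀ i, ContDiffAt ℝ ∞ (X i) x)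
    (hx : x ∈ U) (j k l : Fin n) :
    covDeriv₂ G (skewPart G X) j k l x
      = metricForm G x (stdVec j) (lieConn (connMap G) (vecField X) x (stdVec l) (stdVec k)
          + curv (connMap G) x (stdVec l) (vecField X x) (stdVec k))
        - dirD (stdVec l) f x * metricForm G x (stdVec j) (stdVec k) := by
  have hL := h.isLeviCivitaOn
  have hg := differentiableAt_of_smooth (h.contDiffAt_metricForm hx)
  have hΓ := h.contDiffAt_connMap hx
  have hξ := contDiffAt_vecField (hX x hx)
  have hf := differentiableAt_of_smooth (hc.smooth_char x hx)
  have hk : ∀ a : Coord n, DifferentiableAt ℝ (fun _ : Coord n => a) x :=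
    fun a => differentiableAt_const a
  have hA : DifferentiableAt ℝ (fun y => covField (connMap G) (vecField X) y (stdVec k)) x :=
    differentiableAt_of_smooth ((contDiffAt_dirD hξ _).add
      ((hΓ.clm_apply contDiffAt_const).clm_apply hξ))
  have hgA : DifferentiableAt ℝ (fun y => metricForm G y (stdVec j)
      (covField (connMap G) (vecField X) y (stdVec k))) x := (hg.clm_apply (hk _)).clm_apply hA
  have hgk : DifferentiableAt ℝ (fun y => metricForm G y (stdVec j) (stdVec k)) x :=
    (hg.clm_apply (hk _)).clm_apply (hk _)
  have e := dirD_congr (Filter.mem_of_superset (h.isOpen.mem_nhds hx) fun y hy =>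
    h.skewPart_eq hc hy (hX y hy) j k) (stdVec l)
  rw [covDeriv₂_eq G (b := fun u v => metricForm G x u (covField (connMap G) (vecField X) x v)
    - f x * metricForm G x u v) _ _ (h.skewPart_eq hc hx (hX x hx)), e,
    dirD_sub hgA (hf.fun_mul hgk), dirD_bilin_apply hg (hk _) hA, dirD_mul hf hgk,
    dirD_bilin_const hg, ← dirD_covField hΓ (hL.conn_symm x hx)
      (fun z u v => hL.dirD_conn_symm hx z u v) hξ]
  · simp only [hL.compat x hx, dirD_const, map_zero, zero_apply, map_add, map_sub]
    ring
  · exact fun v => ⟨fun a b => by simp only [map_add, add_apply]; ring,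
      fun c a => by simp only [map_smul, smul_apply, smul_eq_mul]; ring⟩
  · exact fun u => ⟨fun a b => by
        rw [(isLinearMap_covField _ _ x).map_add]; simp only [map_add]; ring,
      fun c a => by
        rw [(isLinearMap_covField _ _ x).map_smul]; simp only [map_smul, smul_eq_mul]; ring⟩

/-- The divergence of the skew part of a conformal field:
`div P = (n - 1) df + Ric(ξ, ·)`. -/
theorem divSkewPart_eq (h : IsMetricOn G U)
    (hc : IsConformalOn (metricForm G) (vecField X) f U) (hX : ∀ x ∈ U, ∀ i, ContDiffAt ℝ ∞ (X i) x)
    (hx : x ∈ U) (k : Fin n) :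
    divSkewPart G X k x = ((n : ℝ) - 1) * dirD (stdVec k) f x
      + ricForm (connMap G) x (vecField X x) (stdVec k) := by
  have s1 := h.isLeviCivitaOn.sum_lieConn_add_curv hc hx
    (fun z => h.metricForm_grad hx f z) (stdVec k)
  have s2 : ∑ l, ∑ j, gInv G l j x * (dirD (stdVec l) f x
      * metricForm G x (stdVec j) (stdVec k)) = dirD (stdVec k) f x := by
    have : ∀ l, ∑ j, gInv G l j x * (dirD (stdVec l) f x
      * metricForm G x (stdVec j) (stdVec k)) = dirD (stdVec l) f x * (stdVec k : Coord n) l := by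
      intro l
      rw [← h.isInverseGram hx (stdVec k) l, Finset.mul_sum]
      exact Finset.sum_congr rfl fun j _ => by ring
    simp only [this]
    exact sum_mul_apply_stdVec (isLinearMap_dirD f x) (stdVec k)
  rw [← sum_sum_comm_apply (h.isInverseGram hx)
    (fun w => lieConn (connMap G) (vecField X) x w (stdVec k)
      + curv (connMap G) x w (vecField X x) (stdVec k))] at s1
  rw [divSkewPart, Finset.sum_comm]
  simp only [h.covDeriv₂_skewPart hc hX hx, mul_sub, Finset.sum_sub_distrib, h.gInv_symm hx _]
  have s1' : ∑ l, ∑ j, gInv G l j x * metricForm G x (stdVec j)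
      (lieConn (connMap G) (vecField X) x (stdVec l) (stdVec k)
      + curv (connMap G) x (stdVec l) (vecField X x) (stdVec k))
      = n * dirD (stdVec k) f x + ric (connMap G) x (vecField X x) (stdVec k) := s1
  rw [s1', s2, ricForm_apply]
  ring

theorem covDeriv₁_divSkewPart (h : IsMetricOn G U)
    (hc : IsConformalOn (metricForm G) (vecField X) f U) (hX : ∀ x ∈ U, ∀ i, ContDiffAt ℝ ∞ (X i) x)
    (hx : x ∈ U) (k i : Fin n) :
    covDeriv₁ G (divSkewPart G X) k i x
      = ((n : ℝ) - 1) * hessian (connMap G) f x (stdVec i) (stdVec k)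
        + covRic (connMap G) x (stdVec i) (vecField X x) (stdVec k)
        + ricForm (connMap G) x (covField (connMap G) (vecField X) x (stdVec i)) (stdVec k) := by
  have hR := differentiableAt_of_smooth (contDiffAt_ricForm (h.contDiffAt_connMap hx))
  have hξ := differentiableAt_of_smooth (contDiffAt_vecField (hX x hx))
  have hDf := differentiableAt_of_smooth (contDiffAt_dirD (hc.smooth_char x hx) (stdVec k))
  have e := dirD_congr (Filter.mem_of_superset (h.isOpen.mem_nhds hx) fun y hy =>
    h.divSkewPart_eq hc hX hy k) (stdVec i)
  have t2 : DifferentiableAt ℝ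
      (fun y => ricForm (connMap G) y (vecField X y) (stdVec k)) x :=
    (hR.clm_apply hξ).clm_apply (differentiableAt_const _)
  rw [covDeriv₁_eq G (a := fun v => ((n : ℝ) - 1) * dirD v f x
      + ricForm (connMap G) x (vecField X x) v) _ (h.divSkewPart_eq hc hX hx), e,
    dirD_add (hDf.const_mul _) t2, dirD_bilin_apply hR hξ (differentiableAt_const _),
    dirD_mul (differentiableAt_const _) hDf]
  · simp only [dirD_const, covRic, covField, hessian, map_add, map_zero, add_apply]
    have e' : dirD (stdVec i) (fun y => dirD (stdVec k) f y) x
        = dirD (stdVec i) (dirD (stdVec k) f) x := rfl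
    ring
  · exact ⟨fun a b => by simp only [dirD_add_dir, map_add]; ring,
      fun c a => by simp only [dirD_smul_dir, map_smul, smul_eq_mul]; ring⟩

/-- The Cotton tensor in terms of the covariant derivative of the Ricci tensor; the metric factor of
the Schouten tensor is parallel. -/
theorem cotton_eq (h : IsMetricOn G U) (hx : x ∈ U) (i j k : Fin n) :
    cotton G i j k x = covRic (connMap G) x (stdVec k) (stdVec i) (stdVec j)
      - covRic (connMap G) x (stdVec j) (stdVec i) (stdVec k)
      - (pd k (scalarCurv G) x * G x i j - pd j (scalarCurv G) x * G x i k)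
        / (2 * ((n : ℝ) - 1)) := by
  have hR := differentiableAt_of_smooth (contDiffAt_ricForm (h.contDiffAt_connMap hx))
  have hg := differentiableAt_of_smooth (h.contDiffAt_metricForm hx)
  have hs : DifferentiableAt ℝ (fun y => scalarCurv G y / (2 * ((n : ℝ) - 1))) x := by
    simpa only [div_eq_mul_inv] using
      (differentiableAt_of_smooth (h.contDiffAt_scalarCurv hx)).mul_const _
  have hk : ∀ a : Coord n, DifferentiableAt ℝ (fun _ : Coord n => a) x :=
    fun a => differentiableAt_const a
  have hA : ∀ y ∈ U, ∀ i j, schouten G i j y = ricForm (connMap G) y (stdVec i) (stdVec j)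
      - scalarCurv G y / (2 * ((n : ℝ) - 1)) * metricForm G y (stdVec i) (stdVec j) :=
    fun y hy i j => by rw [schouten, h.ricci_eq hy, metricForm_stdVec]
  have hds : ∀ w, dirD w (fun y => scalarCurv G y / (2 * ((n : ℝ) - 1))) x
      = dirD w (scalarCurv G) x / (2 * ((n : ℝ) - 1)) := fun w => by
    simp only [div_eq_mul_inv]
    rw [dirD_mul (differentiableAt_of_smooth (h.contDiffAt_scalarCurv hx))
      (differentiableAt_const _), dirD_const]
    ring
  have key : ∀ i j k, covDeriv₂ G (schouten G) i j k x
      = covRic (connMap G) x (stdVec k) (stdVec i) (stdVec j)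
        - pd k (scalarCurv G) x / (2 * ((n : ℝ) - 1)) * G x i j := by
    intro i j k
    have e := dirD_congr (Filter.mem_of_superset (h.isOpen.mem_nhds hx) fun y hy =>
      hA y hy i j) (stdVec k)
    have t1 : DifferentiableAt ℝ (fun y => ricForm (connMap G) y (stdVec i) (stdVec j)) x :=
      (hR.clm_apply (hk _)).clm_apply (hk _)
    have t2 : DifferentiableAt ℝ (fun y => metricForm G y (stdVec i) (stdVec j)) x :=
      (hg.clm_apply (hk _)).clm_apply (hk _)
    rw [covDeriv₂_eq G (b := fun u v => ricForm (connMap G) x u v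
      - scalarCurv G x / (2 * ((n : ℝ) - 1)) * metricForm G x u v) _ _ (hA x hx), e,
      dirD_sub t1 (hs.fun_mul t2), dirD_bilin_const hR, dirD_mul hs t2, hds, dirD_bilin_const hg,
      h.isLeviCivitaOn.compat x hx, metricForm_stdVec, covRic, pd_eq_dirD]
    · ring
    · exact fun v => ⟨fun a b => by simp only [map_add, add_apply]; ring,
        fun c a => by simp only [map_smul, smul_apply, smul_eq_mul]; ring⟩
    · exact fun u => ⟨fun a b => by simp only [map_add]; ring,
        fun c a => by simp only [map_smul, smul_eq_mul]; ring⟩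
  rw [cotton, key, key]
  ring

theorem covRic_symm (h : IsMetricOn G U) (hx : x ∈ U) (w u v : Coord n) :
    covRic (connMap G) x w u v = covRic (connMap G) x w v u := by
  have hR := differentiableAt_of_smooth (contDiffAt_ricForm (h.contDiffAt_connMap hx))
  have e : dirD w (ricForm (connMap G)) x u v = dirD w (ricForm (connMap G)) x v u := by
    rw [← dirD_bilin_const hR, ← dirD_bilin_const hR]
    exact dirD_congr (Filter.mem_of_superset (h.isOpen.mem_nhds hx)
      fun y hy => h.ricForm_symm hy u v) w
  rw [covRic, covRic, e, h.ricForm_symm hx _ v, h.ricForm_symm hx u]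
  ring

/-- The local form of the identity: for a conformal field, `L_g^* f = Φ`. Expanding the Cotton
tensor and `div P`, the tensor `Φ` becomes `L_ξ Ric + (n - 1) Hess f - f Ric`. -/
theorem lStar_eq_phi (h : IsMetricOn G U) (hX : ∀ x ∈ U, ∀ i, ContDiffAt ℝ ∞ (X i) x)
    (hf : ∀ x ∈ U, ContDiffAt ℝ ∞ f x)
    (hl : ∀ x ∈ U, ∀ i j, lieDerivMetric G X i j x = 2 * f x * G x i j) (hx : x ∈ U)
    (i k : Fin n) : lStar G f i k x = phi G X i k x := by
  have hL := h.isLeviCivitaOn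
  have hc := h.isConformalOn hX hf hl
  have hR := differentiableAt_of_smooth (contDiffAt_ricForm (h.contDiffAt_connMap hx))
  have hlie := hL.lie_ric hc hx (differentiableAt_of_smooth (h.contDiffAt_grad hx (hf x hx)))
    (fun y hy => h.metricForm_grad hy f) (stdVec i) (stdVec k)
  simp only [← ricForm_apply] at hlie
  rw [dirD_bilin_const hR, ← h.laplacian_eq hx (hf x hx), metricForm_stdVec] at hlie
  have s1 : ∑ l, cotton G k l i x * X l x
      = covRic (connMap G) x (stdVec i) (stdVec k) (vecField X x)
        - covRic (connMap G) x (vecField X x) (stdVec k) (stdVec i)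
        - (pd i (scalarCurv G) x * flat G X k x
          - (∑ l, X l x * pd l (scalarCurv G) x) * G x k i) / (2 * ((n : ℝ) - 1)) := by
    rw [← sum_smul_apply_stdVec (isLinearMap_covRic_right _ x _ _) (vecField X x),
      ← sum_smul_apply_stdVec (isLinearMap_covRic (connMap G) x _ _) (vecField X x), flat,
      Finset.mul_sum, Finset.sum_mul, ← Finset.sum_sub_distrib, ← Finset.sum_sub_distrib,
      Finset.sum_div, ← Finset.sum_sub_distrib]
    refine Finset.sum_congr rfl fun l _ => ?_
    rw [h.cotton_eq hx, vecField_apply, smul_eq_mul, smul_eq_mul]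
    ring
  have s2 : ∑ l, ∑ m, ricci G i l x * gInv G l m x * skewPart G X m k x
      = ricForm (connMap G) x (stdVec i) (covField (connMap G) (vecField X) x (stdVec k))
        - f x * ricForm (connMap G) x (stdVec i) (stdVec k) := by
    have : ∀ l, ∑ m, ricci G i l x * gInv G l m x * skewPart G X m k x
        = (covField (connMap G) (vecField X) x (stdVec k) - f x • stdVec k : Coord n) l
          • ricForm (connMap G) x (stdVec i) (stdVec l) := by
      intro l
      rw [← h.isInverseGram hx (covField (connMap G) (vecField X) x (stdVec k) - f x • stdVec k) l,
        smul_eq_mul, Finset.sum_mul]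
      refine Finset.sum_congr rfl fun m _ => ?_
      rw [h.ricci_eq hx, h.skewPart_eq hc hx (hX x hx), map_sub, map_smul, smul_eq_mul]
      ring
    simp only [this]
    rw [sum_components_right, map_sub, map_smul, smul_eq_mul]
  rw [phi, s1, s2, h.covDeriv₁_divSkewPart hc hX hx, lStar, hess_eq, h.ricci_eq hx,
    h.covRic_symm hx (stdVec i) (vecField X x), h.covRic_symm hx (vecField X x), h.symm x hx k i,
    covRic, covRic]
  simp only [covField, map_add, add_apply, hL.conn_symm x hx (vecField X x)]
  linear_combination -hlie

end IsMetricOn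

end ConformalIdentity

/-! ### Change of coordinates -/

section ChangeOfCoordinates

theorem dirD_comp {E E' F : Type*} [NormedAddCommGroup E] [NormedSpace ℝ E]
    [NormedAddCommGroup E'] [NormedSpace ℝ E'] [NormedAddCommGroup F] [NormedSpace ℝ F]
    {h : E' → F} {φ : E → E'} {x : E} (hh : DifferentiableAt ℝ h (φ x))
    (hφ : DifferentiableAt ℝ φ x) (w : E) :
    dirD w (fun y => h (φ y)) x = dirD (dirD w φ x) h (φ x) := by
  have := congrArg (fun L => L w) (fderiv_comp x hh hφ)
  simpa [dirD, Function.comp_def] using this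

theorem differentiableAt_fun_comp {E E' F : Type*} [NormedAddCommGroup E] [NormedSpace ℝ E]
    [NormedAddCommGroup E'] [NormedSpace ℝ E'] [NormedAddCommGroup F] [NormedSpace ℝ F]
    {h : E' → F} {φ : E → E'} {x : E} (hh : DifferentiableAt ℝ h (φ x))
    (hφ : DifferentiableAt ℝ φ x) : DifferentiableAt ℝ (fun y => h (φ y)) x :=
  hh.comp x hφ

/-- `φ` is a smooth local isometry on the open set `V` from the metric `g` to the metric `g'`,
with values in `U'`. -/
structure IsIsometryOn {E : Type*} [NormedAddCommGroup E] [NormedSpace ℝ E]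
    (g g' : E → E →L[ℝ] E →L[ℝ] ℝ) (φ : E → E) (V U' : Set E) : Prop where
  isOpen : IsOpen V
  smooth : ∀ x ∈ V, ContDiffAt ℝ ∞ φ x
  mapsTo : ∀ x ∈ V, φ x ∈ U'
  bijective : ∀ x ∈ V, Function.Bijective (fderiv ℝ φ x)
  pullback : ∀ x ∈ V, ∀ u v, g x u v = g' (φ x) (dirD u φ x) (dirD v φ x)

namespace IsIsometryOn

variable {E : Type*} [NormedAddCommGroup E] [NormedSpace ℝ E]
  {g g' : E → E →L[ℝ] E →L[ℝ] ℝ} {Γ Γ' : E → E →L[ℝ] E →L[ℝ] E} {φ : E → E}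
  {U V U' : Set E} {x : E}

theorem ext_metric (i : IsIsometryOn g g' φ V U') (h' : IsLeviCivitaOn g' Γ' U')
    (hx : x ∈ V) {a b : E} (hab : ∀ v, g' (φ x) a (dirD v φ x) = g' (φ x) b (dirD v φ x)) :
    a = b := by
  refine h'.ext_metric (i.mapsTo x hx) fun z => ?_
  obtain ⟨v, rfl⟩ := (i.bijective x hx).2 z
  exact hab v

set_option synthInstance.maxHeartbeats 200000 in
/-- The transformation law of the Christoffel symbols. -/
theorem conn_law (i : IsIsometryOn g g' φ V U') (h : IsLeviCivitaOn g Γ U)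
    (h' : IsLeviCivitaOn g' Γ' U') (hVU : V ⊆ U) (hx : x ∈ V) (u v : E) :
    dirD (Γ x u v) φ x
      = dirD u (dirD v φ) x + Γ' (φ x) (dirD u φ x) (dirD v φ x) := by
  have hU := hVU hx
  have hU' := i.mapsTo x hx
  have hφ := i.smooth x hx
  have hdφ := differentiableAt_of_smooth hφ
  have hg' := differentiableAt_of_smooth (h'.smooth_metric _ hU')
  have hcomp : DifferentiableAt ℝ (fun y => g' (φ y)) x := differentiableAt_fun_comp hg' hdφ
  have hg := differentiableAt_of_smooth (h.smooth_metric x hU)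
  have hD := fun a => differentiableAt_of_smooth (contDiffAt_dirD hφ a)
  -- The difference of the two sides, paired with `Dφ v`, is symmetric in its first two arguments
  -- and skew in its last two.
  have key : ∀ w u v,
      g' (φ x) (dirD (Γ x w u) φ x - dirD w (dirD u φ) x
        - Γ' (φ x) (dirD w φ x) (dirD u φ x)) (dirD v φ x)
      + g' (φ x) (dirD (Γ x w v) φ x - dirD w (dirD v φ) x
        - Γ' (φ x) (dirD w φ x) (dirD v φ x)) (dirD u φ x) = 0 := by
    intro w u v
    have e := dirD_congr (Filter.mem_of_superset (i.isOpen.mem_nhds hx)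
      fun y hy => i.pullback y hy u v) w
    rw [dirD_bilin_const hg, h.compat x hU, i.pullback x hx, i.pullback x hx,
      dirD_bilin_apply hcomp (hD u) (hD v), dirD_comp hg' hdφ, h'.compat _ hU'] at e
    have s := h'.metric_symm _ hU' (dirD u φ x)
    rw [s, s, s] at e
    simp only [map_sub, sub_apply]
    linarith
  have sym : ∀ w u, dirD (Γ x w u) φ x - dirD w (dirD u φ) x
      - Γ' (φ x) (dirD w φ x) (dirD u φ x) = dirD (Γ x u w) φ x - dirD u (dirD w φ) x
      - Γ' (φ x) (dirD u φ x) (dirD w φ x) := fun w u => by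
    rw [h.conn_symm x hU w, dirD_comm hφ w, h'.conn_symm _ hU' (dirD w φ x)]
  rw [← sub_eq_zero, ← sub_sub]
  refine i.ext_metric h' hx fun z => ?_
  have k1 := key u v z
  have k2 := key v u z
  have k3 := key z u v
  rw [sym v u] at k2
  rw [sym z u, sym z v] at k3
  rw [map_zero, zero_apply]
  linarith

set_option synthInstance.maxHeartbeats 200000 in
/-- The transformation law of the curvature. -/
theorem curv_law (i : IsIsometryOn g g' φ V U') (h : IsLeviCivitaOn g Γ U)
    (h' : IsLeviCivitaOn g' Γ' U') (hVU : V ⊆ U) (hx : x ∈ V) (w u v : E) :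
    dirD (curv Γ x w u v) φ x
      = curv Γ' (φ x) (dirD w φ x) (dirD u φ x) (dirD v φ x) := by
  have hU := hVU hx
  have hU' := i.mapsTo x hx
  have hφ := i.smooth x hx
  have hdφ := differentiableAt_of_smooth hφ
  have hΓ := differentiableAt_of_smooth (h.smooth_conn x hU)
  have hΓ' := differentiableAt_of_smooth (h'.smooth_conn _ hU')
  have hcomp : DifferentiableAt ℝ (fun y => Γ' (φ y)) x := differentiableAt_fun_comp hΓ' hdφ
  have hD := fun a => differentiableAt_of_smooth (contDiffAt_dirD hφ a)
  -- The derivative in direction `w` of the transformation law of `Γ(u, v)`. The terms that are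
  -- symmetric in `w` and `u` drop out of the curvature.
  have key : ∀ w u, dirD (dirD w Γ x u v) φ x + dirD (Γ x w (Γ x u v)) φ x =
      dirD w (dirD u (dirD v φ)) x
      + dirD (dirD w φ x) Γ' (φ x) (dirD u φ x) (dirD v φ x)
      + Γ' (φ x) (dirD w (dirD u φ) x) (dirD v φ x)
      + Γ' (φ x) (dirD u φ x) (dirD w (dirD v φ) x)
      + Γ' (φ x) (dirD w φ x) (dirD u (dirD v φ) x)
      + Γ' (φ x) (dirD w φ x) (Γ' (φ x) (dirD u φ x) (dirD v φ x)) := by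
    intro w u
    have hΓuv : DifferentiableAt ℝ (fun y => Γ y u v) x :=
      (hΓ.clm_apply (differentiableAt_const _)).clm_apply (differentiableAt_const _)
    have t1 : DifferentiableAt ℝ (fun y => Γ' (φ y) (dirD u φ y) (dirD v φ y)) x :=
      (hcomp.clm_apply (hD u)).clm_apply (hD v)
    have e := dirD_congr (Filter.mem_of_superset (i.isOpen.mem_nhds hx)
      fun y hy => i.conn_law h h' hVU hy u v) w
    rw [dirD_dirD_var hφ hΓuv, dirD_bilin_const hΓ,
      dirD_add (differentiableAt_of_smooth (contDiffAt_dirD (contDiffAt_dirD hφ v) u)) t1,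
      dirD_bilin_apply hcomp (hD u) (hD v), dirD_comp hΓ' hdφ] at e
    rw [i.conn_law h h' hVU hx w (Γ x u v), i.conn_law h h' hVU hx u v, map_add,
      eq_sub_of_add_eq' e]
    abel
  have k1 := key w u
  have k2 := key u w
  rw [dirD_comm (contDiffAt_dirD hφ v) u w, dirD_comm hφ u w] at k2
  have e : dirD (curv Γ x w u v) φ x
      = (dirD (dirD w Γ x u v) φ x + dirD (Γ x w (Γ x u v)) φ x)
        - (dirD (dirD u Γ x w v) φ x + dirD (Γ x u (Γ x w v)) φ x) := by
    rw [curv_apply, dirD_add_dir, dirD_sub_dir, dirD_sub_dir]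
    abel
  rw [e, k1, k2, curv_apply]
  abel

/-- The Hessian of a function is a tensor. -/
theorem hessian_law (i : IsIsometryOn g g' φ V U') (h : IsLeviCivitaOn g Γ U)
    (h' : IsLeviCivitaOn g' Γ' U') (hVU : V ⊆ U) (hx : x ∈ V) {f f' : E → ℝ}
    (hf' : ∀ y ∈ U', ContDiffAt ℝ ∞ f' y) (hff : ∀ y ∈ V, f y = f' (φ y)) (u v : E) :
    hessian Γ f x u v = hessian Γ' f' (φ x) (dirD u φ x) (dirD v φ x) := by
  have hφ := i.smooth x hx
  have hdφ := differentiableAt_of_smooth hφ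
  have e : ∀ y ∈ V, ∀ w, dirD w f y = dirD (dirD w φ y) f' (φ y) := fun y hy w => by
    rw [← dirD_comp (differentiableAt_of_smooth (hf' _ (i.mapsTo y hy)))
      (differentiableAt_of_smooth (i.smooth y hy))]
    exact dirD_congr (Filter.mem_of_superset (i.isOpen.mem_nhds hy) fun z hz => hff z hz) w
  have hdf' : DifferentiableAt ℝ (fun y => fderiv ℝ f' (φ y)) x :=
    (differentiableAt_of_smooth
      ((hf' _ (i.mapsTo x hx)).fderiv_right (m := ∞) (by simp))).comp x hdφ
  have hdf'' := differentiableAt_of_smooth ((hf' _ (i.mapsTo x hx)).fderiv_right (m := ∞) (by simp))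
  have e2 : dirD u (dirD v f) x = dirD (dirD u φ x) (dirD (dirD v φ x) f') (φ x)
      + dirD (dirD u (dirD v φ) x) f' (φ x) := by
    rw [dirD_congr (Filter.mem_of_superset (i.isOpen.mem_nhds hx) fun y hy => e y hy v) u]
    change dirD u (fun y => fderiv ℝ f' (φ y) (dirD v φ y)) x = _
    rw [dirD_lin_apply hdf' (differentiableAt_of_smooth (contDiffAt_dirD hφ v)),
      dirD_comp hdf'' hdφ]
    congr 1
    change _ = dirD (dirD u φ x) (fun y => fderiv ℝ f' y (dirD v φ x)) (φ x)
    rw [dirD_lin_apply hdf'' (differentiableAt_const _), dirD_const, map_zero, add_zero]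
  rw [hessian, hessian, e2, e x hx, i.conn_law h h' hVU hx, dirD_add_dir]
  ring

end IsIsometryOn

section Trace

variable {n : ℕ} {φ : Coord n → Coord n} {V U U' : Set (Coord n)} {x : Coord n}

/-- Endomorphisms intertwined by an isomorphism have the same trace. -/
theorem sum_eq_of_intertwine {J : Coord n →L[ℝ] Coord n} (hJ : Function.Bijective J)
    {L L' : Coord n → Coord n} (hL : IsLinearMap ℝ L) (hL' : IsLinearMap ℝ L')
    (h : ∀ w, J (L w) = L' (J w)) :
    ∑ i, L (stdVec i) i = ∑ i, L' (stdVec i) i := by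
  let e := LinearEquiv.ofBijective J.toLinearMap hJ
  have t := LinearMap.trace_conj' hL.mk' e
  have he : e.conj hL.mk' = hL'.mk' := by
    refine LinearMap.ext fun v => ?_
    obtain ⟨w, rfl⟩ := e.surjective v
    rw [LinearEquiv.conj_apply_apply, LinearEquiv.symm_apply_apply]
    exact h w
  rw [he, trace_eq_sum, trace_eq_sum] at t
  exact t.symm

theorem IsIsometryOn.ric_law {g g' : Coord n → Coord n →L[ℝ] Coord n →L[ℝ] ℝ}
    {Γ Γ' : Coord n → Coord n →L[ℝ] Coord n →L[ℝ] Coord n}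
    (i : IsIsometryOn g g' φ V U') (h : IsLeviCivitaOn g Γ U)
    (h' : IsLeviCivitaOn g' Γ' U') (hVU : V ⊆ U) (hx : x ∈ V) (u v : Coord n) :
    ric Γ x u v = ric Γ' (φ x) (dirD u φ x) (dirD v φ x) :=
  sum_eq_of_intertwine (i.bijective x hx) (curvEnd Γ x u v).isLinear
    (curvEnd Γ' (φ x) (dirD u φ x) (dirD v φ x)).isLinear
    fun w => i.curv_law h h' hVU hx w u v

variable {G G' : Coord n → Matrix (Fin n) (Fin n) ℝ} {f f' : Coord n → ℝ}

theorem IsIsometryOn.laplacian_law (i : IsIsometryOn (metricForm G) (metricForm G') φ V U')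
    (h : IsMetricOn G U) (h' : IsMetricOn G' U') (hVU : V ⊆ U) (hx : x ∈ V)
    (hf : ∀ y ∈ U, ContDiffAt ℝ ∞ f y) (hf' : ∀ y ∈ U', ContDiffAt ℝ ∞ f' y)
    (hff : ∀ y ∈ V, f y = f' (φ y)) :
    laplacian G f x = laplacian G' f' (φ x) := by
  have hU' := i.mapsTo x hx
  rw [h.laplacian_eq (hVU hx) (hf x (hVU hx)), h'.laplacian_eq hU' (hf' _ hU')]
  refine sum_eq_of_intertwine (i.bijective x hx) (isLinearMap_covField _ _ _)
    (isLinearMap_covField _ _ _) fun w => i.ext_metric h'.isLeviCivitaOn hx fun v => ?_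
  have e := i.pullback x hx (covField (connMap G) (grad G f) x w) v
  refine e.symm.trans ?_
  rw [h.isLeviCivitaOn.metric_covField_grad (hVU hx)
      (differentiableAt_of_smooth (h.contDiffAt_grad (hVU hx) (hf x (hVU hx))))
      (fun y hy => h.metricForm_grad hy f),
    i.hessian_law h.isLeviCivitaOn h'.isLeviCivitaOn hVU hx hf' hff]
  exact (h'.isLeviCivitaOn.metric_covField_grad hU'
      (differentiableAt_of_smooth (h'.contDiffAt_grad hU' (hf' _ hU')))
      (fun y hy => h'.metricForm_grad hy f') _ _).symm

/-- The bilinear form `L_g^* f` at a point. -/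
def lStarForm (G : Coord n → Matrix (Fin n) (Fin n) ℝ) (f : Coord n → ℝ) (x : Coord n) :
    Coord n →L[ℝ] Coord n →L[ℝ] ℝ :=
  bilForm fun i j => lStar G f i j x

theorem IsMetricOn.lStarForm_apply (h : IsMetricOn G U) (hx : x ∈ U)
    (hf : ContDiffAt ℝ ∞ f x) (u v : Coord n) :
    lStarForm G f x u v = hessian (connMap G) f x u v - laplacian G f x * metricForm G x u v
      - f x * ric (connMap G) x u v := by
  have hr : ∀ u, IsLinearMap ℝ fun v => hessian (connMap G) f x u v
      - laplacian G f x * metricForm G x u v - f x * ric (connMap G) x u v := fun u => by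
    simp only [h.isLeviCivitaOn.hessian_symm hx hf u, ← ricForm_apply]
    exact ⟨fun a b => by
        rw [(isLinearMap_hessian x u).map_add]; simp only [map_add]; ring,
      fun c a => by
        rw [(isLinearMap_hessian x u).map_smul]; simp only [map_smul, smul_eq_mul]; ring⟩
  have hl : ∀ v, IsLinearMap ℝ fun u => hessian (connMap G) f x u v
      - laplacian G f x * metricForm G x u v - f x * ric (connMap G) x u v := fun v => by
    simp only [← ricForm_apply]
    exact ⟨fun a b => by
        rw [(isLinearMap_hessian x v).map_add]; simp only [map_add, add_apply]; ring,
      fun c a => by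
        rw [(isLinearMap_hessian x v).map_smul]
        simp only [map_smul, smul_apply, smul_eq_mul]; ring⟩
  refine ext_stdVec (isLinearMap_apply_left _ v) (hl v) (fun i => ?_) u
  refine ext_stdVec (isLinearMap_clm _) (hr _) (fun j => ?_) v
  rw [lStarForm, bilForm_stdVec, lStar, hess_eq, h.ricci_eq hx, ricForm_apply, metricForm_stdVec]

theorem IsMetricOn.lStarForm_symm (h : IsMetricOn G U) (hx : x ∈ U)
    (hf : ContDiffAt ℝ ∞ f x) (u v : Coord n) :
    lStarForm G f x u v = lStarForm G f x v u := by
  rw [h.lStarForm_apply hx hf, h.lStarForm_apply hx hf, h.isLeviCivitaOn.hessian_symm hx hf,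
    h.metricForm_symm hx, h.isLeviCivitaOn.ric_symm hx (h.isInverseGram hx)]

/-- `L_g^* f` is a tensor. -/
theorem IsIsometryOn.lStarForm_law (i : IsIsometryOn (metricForm G) (metricForm G') φ V U')
    (h : IsMetricOn G U) (h' : IsMetricOn G' U') (hVU : V ⊆ U) (hx : x ∈ V)
    (hf : ∀ y ∈ U, ContDiffAt ℝ ∞ f y) (hf' : ∀ y ∈ U', ContDiffAt ℝ ∞ f' y)
    (hff : ∀ y ∈ V, f y = f' (φ y)) (u v : Coord n) :
    lStarForm G f x u v = lStarForm G' f' (φ x) (dirD u φ x) (dirD v φ x) := by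
  have hU' := i.mapsTo x hx
  rw [h.lStarForm_apply (hVU hx) (hf x (hVU hx)), h'.lStarForm_apply hU' (hf' _ hU'),
    i.hessian_law h.isLeviCivitaOn h'.isLeviCivitaOn hVU hx hf' hff,
    i.laplacian_law h h' hVU hx hf hf' hff, i.pullback x hx, hff x hx,
    i.ric_law h.isLeviCivitaOn h'.isLeviCivitaOn hVU hx]

theorem IsMetricOn.contDiffAt_lStar (h : IsMetricOn G U) (hx : x ∈ U)
    (hf : ContDiffAt ℝ ∞ f x) (i j : Fin n) : ContDiffAt ℝ ∞ (lStar G f i j) x := by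
  have hh : ∀ i j, ContDiffAt ℝ ∞ (hess G f i j) x := fun i j =>
    (contDiffAt_pd (contDiffAt_pd hf j) i).sub
      (ContDiffAt.sum fun k _ => (h.contDiffAt_christoffel hx k i j).mul (contDiffAt_pd hf k))
  have hl : ContDiffAt ℝ ∞ (laplacian G f) x :=
    ContDiffAt.sum fun i _ => ContDiffAt.sum fun j _ => (h.contDiffAt_gInv hx i j).mul (hh i j)
  exact ((hh i j).sub (hl.mul (h.smooth x hx i j))).sub (hf.mul (h.contDiffAt_ricci hx i j))

end Trace

end ChangeOfCoordinates

/-! ### Charts of a manifold -/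

section Charts

variable {n : ℕ} {M : Type*} [TopologicalSpace M] [ChartedSpace (Coord n) M]

/-- The derivative of the inverse of a chart: the vector at `e.symm x` with components `u`. -/
def chartSymmD (e : OpenPartialHomeomorph M (Coord n)) (x : Coord n) :
    Coord n →L[ℝ] TangentSpace (𝓡 n) (e.symm x) :=
  mfderiv (𝓡 n) (𝓡 n) e.symm x

theorem coordVec_eq (e : OpenPartialHomeomorph M (Coord n)) (i : Fin n) (x : Coord n) :
    coordVec e i x = chartSymmD e x (stdVec i) := rfl

/-- Evaluation of a `(0,2)`-tensor field on vectors given by their components in a chart. -/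
theorem tensor_chartSymmD (e : OpenPartialHomeomorph M (Coord n)) (T : Tensor02 n M)
    (x u v : Coord n) :
    T (e.symm x) (chartSymmD e x u) (chartSymmD e x v)
      = bilForm (fun i j => tensorComp e T i j x) u v := by
  refine ext_stdVec (α := fun u => T (e.symm x) (chartSymmD e x u) (chartSymmD e x v))
    ⟨fun a b => by simp, fun c a => by simp⟩ (isLinearMap_apply_left _ v) (fun i => ?_) u
  refine ext_stdVec (α := fun v => T (e.symm x) (chartSymmD e x (stdVec i)) (chartSymmD e x v))
    ⟨fun a b => by simp, fun c a => by simp⟩ (isLinearMap_clm _) (fun j => ?_) v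
  rw [bilForm_stdVec]
  rfl

variable {e e' : OpenPartialHomeomorph M (Coord n)} {x : Coord n}

theorem IsChart.contMDiffAt (he : IsChart e) {p : M} (hp : p ∈ e.source) :
    ContMDiffAt (𝓡 n) (𝓡 n) ∞ e p :=
  contMDiffAt_of_mem_maximalAtlas he hp

theorem IsChart.contMDiffAt_symm (he : IsChart e) (hx : x ∈ e.target) :
    ContMDiffAt (𝓡 n) (𝓡 n) ∞ e.symm x :=
  contMDiffAt_symm_of_mem_maximalAtlas he hx

theorem IsChart.mdifferentiable (he : IsChart e) : e.MDifferentiable (𝓡 n) (𝓡 n) :=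
  ⟨fun _ hp => ((he.contMDiffAt hp).mdifferentiableAt (by simp)).mdifferentiableWithinAt,
    fun _ hx => ((he.contMDiffAt_symm hx).mdifferentiableAt (by simp)).mdifferentiableWithinAt⟩

theorem IsChart.contDiffAt_comp_symm (he : IsChart e) {f : M → ℝ}
    (hf : ContMDiff (𝓡 n) 𝓘(ℝ) ∞ f) (hx : x ∈ e.target) : ContDiffAt ℝ ∞ (f ∘ e.symm) x :=
  ((hf (e.symm x)).comp x (he.contMDiffAt_symm hx)).contDiffAt

theorem IsChart.chartSymmD_bijective (he : IsChart e) (hx : x ∈ e.target) :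
    Function.Bijective (chartSymmD e x) :=
  he.mdifferentiable.symm.mfderiv_bijective hx

theorem IsChart.chartSymmD_mfderiv (he : IsChart e) {p : M} (hp : p ∈ e.source)
    (v : TangentSpace (𝓡 n) p) :
    chartSymmD e (e p) (mfderiv (𝓡 n) (𝓡 n) e p v) = v :=
  congrArg (fun L => L v) (he.mdifferentiable.symm_comp_deriv hp)

variable [IsManifold (𝓡 n) ∞ M]

theorem isChart_chartAt (p : M) : IsChart (n := n) (chartAt (Coord n) p) :=
  IsManifold.chart_mem_maximalAtlas p

/-- The tangent map of a smooth map preserves smoothness of vector fields along a map. -/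
theorem contMDiffAt_mfderiv_apply {N M' M'' : Type*} {k m : ℕ}
    [TopologicalSpace N] [ChartedSpace (Coord k) N]
    [TopologicalSpace M'] [ChartedSpace (Coord n) M'] [IsManifold (𝓡 n) ∞ M']
    [TopologicalSpace M''] [ChartedSpace (Coord m) M''] [IsManifold (𝓡 m) ∞ M'']
    {F : M' → M''} {s : Set M'} (hs : IsOpen s)
    (hF : ContMDiffOn (𝓡 n) (𝓡 m) ∞ F s) {V : N → TangentBundle (𝓡 n) M'} {y : N}
    (hV : ContMDiffAt (𝓡 k) (𝓡 n).tangent ∞ V y) (hy : (V y).1 ∈ s) :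
    ContMDiffAt (𝓡 k) (𝓡 m).tangent ∞
      (fun z => (⟨F (V z).1, mfderiv (𝓡 n) (𝓡 m) F (V z).1 (V z).2⟩ :
        TangentBundle (𝓡 m) M'')) y := by
  have h1 := hF.contMDiffOn_tangentMapWithin (m := ∞) (by simp) hs.uniqueMDiffOn
  have hpre : (Bundle.TotalSpace.proj ⁻¹' s : Set (TangentBundle (𝓡 n) M')) ∈ nhds (V y) :=
    (hs.preimage (Bundle.contMDiff_proj (n := 0) (IB := 𝓡 n) (F := Coord n)
      (TangentSpace (𝓡 n) : M' → Type _)).continuous).mem_nhds hy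
  have h2 := (h1.contMDiffAt hpre).comp y hV
  refine h2.congr_of_eventuallyEq ?_
  filter_upwards [hV.continuousAt hpre] with z hz
  have hz' : (V z).1 ∈ s := hz
  simp only [Function.comp, tangentMapWithin]
  rw [mfderivWithin_of_isOpen hs hz']

theorem contMDiffAt_stdVec (i : Fin n) (x : Coord n) :
    ContMDiffAt (𝓡 n) (𝓡 n).tangent ∞
      (fun y => (⟨y, (stdVec i : Coord n)⟩ : TangentBundle (𝓡 n) (Coord n))) x :=
  contMDiffAt_vectorSpace_iff_contDiffAt.2 contDiffAt_const

/-- The coordinate vector fields are smooth. -/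
theorem IsChart.contMDiffAt_coordVec (he : IsChart e) (hx : x ∈ e.target) (i : Fin n) :
    ContMDiffAt (𝓡 n) (𝓡 n).tangent ∞
      (fun y => (⟨e.symm y, coordVec e i y⟩ : TangentBundle (𝓡 n) M)) x :=
  contMDiffAt_mfderiv_apply e.open_target
    (fun _ hy => (he.contMDiffAt_symm hy).contMDiffWithinAt) (contMDiffAt_stdVec i x) hx

/-- The components of a smooth `(0,2)`-tensor field are smooth. -/
theorem Tensor02.Smooth.contDiffAt_tensorComp {T : Tensor02 n M} (hT : T.Smooth) (he : IsChart e)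
    (hx : x ∈ e.target) (i j : Fin n) : ContDiffAt ℝ ∞ (tensorComp e T i j) x := by
  have h1 : ContMDiffAt (𝓡 n) ((𝓡 n).prod 𝓘(ℝ)) ∞
      (fun y => Bundle.TotalSpace.mk' ℝ (E := Bundle.Trivial M ℝ) (e.symm y)
        (T (e.symm y) (coordVec e i y) (coordVec e j y))) x := by
    apply ContMDiffAt.clm_bundle_apply₂ (F₁ := Coord n) (F₂ := Coord n)
    · exact (hT (e.symm x)).comp x (he.contMDiffAt_symm hx)
    · exact he.contMDiffAt_coordVec hx i
    · exact he.contMDiffAt_coordVec hx j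
  simp only [Bundle.contMDiffAt_totalSpace] at h1
  exact h1.2.contDiffAt

/-- The components of a smooth vector field are smooth. -/
theorem IsChart.contDiffAt_vecComp (he : IsChart e) {ξ : (p : M) → TangentSpace (𝓡 n) p}
    (hξ : ContMDiff (𝓡 n) (𝓡 n).tangent ∞ (fun p => (⟨p, ξ p⟩ : TangentBundle (𝓡 n) M)))
    (hx : x ∈ e.target) (i : Fin n) : ContDiffAt ℝ ∞ (vecComp e ξ i) x := by
  have h1 := contMDiffAt_mfderiv_apply (F := e) e.open_source
    (fun _ hy => (he.contMDiffAt hy).contMDiffWithinAt)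
    ((hξ (e.symm x)).comp x (he.contMDiffAt_symm hx)) (e.map_target hx)
  have h2 := ((contMDiff_snd_tangentBundle_modelSpace (Coord n) (𝓡 n)).contMDiffAt.comp x
    h1).contDiffAt
  exact contDiffAt_euclidean.1 h2 i

variable (g : Metric n M)

theorem metricForm_metricComp (e : OpenPartialHomeomorph M (Coord n)) (x u v : Coord n) :
    metricForm (metricComp g e) x u v
      = g.inner (e.symm x) (chartSymmD e x u) (chartSymmD e x v) :=
  (tensor_chartSymmD e g.inner x u v).symm

theorem isMetricOn_metricComp (he : IsChart e) : IsMetricOn (metricComp g e) e.target where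
  isOpen := e.open_target
  smooth _ hx i j := Tensor02.Smooth.contDiffAt_tensorComp (T := g.inner) g.contMDiff he hx i j
  symm x _ i j := g.symm _ _ _
  isUnit_det x hx := by
    rw [← Matrix.isUnit_iff_isUnit_det, ← Matrix.mulVec_injective_iff_isUnit]
    -- A kernel vector of the Gram matrix would be a nonzero tangent vector of length zero.
    intro a b hab
    by_contra hne
    set u : Coord n := WithLp.toLp 2 (a - b)
    have hu : u ≠ 0 := fun h => hne (by
      have : a - b = 0 := congrArg WithLp.ofLp h
      exact sub_eq_zero.1 this)
    have hpos := g.pos (e.symm x) (chartSymmD e x u) fun h0 => hu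
      ((he.chartSymmD_bijective hx).1 (h0.trans (map_zero _).symm))
    rw [← metricForm_metricComp, ← sum_components_right (metricForm (metricComp g e) x u)] at hpos
    have hzero : ∀ j, metricForm (metricComp g e) x u (stdVec j) = 0 := fun j => by
      have h1 : (metricComp g e x).mulVec (a - b) j = 0 := by
        rw [Matrix.mulVec_sub, hab, sub_self]; rfl
      rw [← sum_smul_apply_stdVec (isLinearMap_apply_left _ (stdVec j)), ← h1, Matrix.mulVec,
        dotProduct]
      refine Finset.sum_congr rfl fun i _ => ?_
      rw [metricForm_stdVec, smul_eq_mul, mul_comm]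
      congr 1
      exact g.symm _ _ _
    simp [hzero] at hpos

/-- A change of charts is an isometry between the coordinate expressions of the metric. -/
theorem isIsometryOn_transition (he : IsChart e) (he' : IsChart e') :
    IsIsometryOn (metricForm (metricComp g e)) (metricForm (metricComp g e')) (e' ∘ e.symm)
      (e.symm.trans e').source e'.target ∧
    ∀ x ∈ (e.symm.trans e').source, ∀ u, dirD u (e' ∘ e.symm) x
      = mfderiv (𝓡 n) (𝓡 n) e' (e.symm x) (chartSymmD e x u) := by
  have hmem : ∀ x ∈ (e.symm.trans e').source, x ∈ e.target ∧ e.symm x ∈ e'.source := fun x hx => by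
    simpa using hx
  have hD : ∀ x ∈ (e.symm.trans e').source, ∀ u, dirD u (e' ∘ e.symm) x
      = mfderiv (𝓡 n) (𝓡 n) e' (e.symm x) (chartSymmD e x u) := fun x hx u => by
    obtain ⟨h1, h2⟩ := hmem x hx
    rw [dirD, ← mfderiv_eq_fderiv, mfderiv_comp x (he'.mdifferentiable.mdifferentiableAt h2)
      (he.mdifferentiable.mdifferentiableAt_symm h1)]
    rfl
  refine ⟨⟨(e.symm.trans e').open_source, fun x hx => ?_, fun x hx => ?_, fun x hx => ?_,
    fun x hx u v => ?_⟩, hD⟩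
  · obtain ⟨h1, h2⟩ := hmem x hx
    exact ((he'.contMDiffAt h2).comp x (he.contMDiffAt_symm h1)).contDiffAt
  · exact e'.map_source (hmem x hx).2
  · obtain ⟨h1, h2⟩ := hmem x hx
    have := (he'.mdifferentiable.mfderiv_bijective h2).comp (he.chartSymmD_bijective h1)
    refine ⟨fun a b hab => this.1 (((hD x hx a).symm.trans hab).trans (hD x hx b)), fun c => ?_⟩
    obtain ⟨a, ha⟩ := this.2 c
    exact ⟨a, (hD x hx a).trans ha⟩
  · obtain ⟨h1, h2⟩ := hmem x hx
    have aux : ∀ p ∈ e'.source, ∀ a b : TangentSpace (𝓡 n) p,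
        g.inner (e'.symm (e' p)) (chartSymmD e' (e' p) (mfderiv (𝓡 n) (𝓡 n) e' p a))
          (chartSymmD e' (e' p) (mfderiv (𝓡 n) (𝓡 n) e' p b)) = g.inner p a b := by
      intro p hp a b
      have e0 : ∀ q, q = p → ∀ a' b' : Coord n,
          (g.inner q : Coord n →L[ℝ] Coord n →L[ℝ] ℝ) a' b'
            = (g.inner p : Coord n →L[ℝ] Coord n →L[ℝ] ℝ) a' b' := by
        rintro q rfl a' b'; rfl
      rw [he'.chartSymmD_mfderiv hp, he'.chartSymmD_mfderiv hp]
      exact e0 _ (e'.left_inv hp) a b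
    rw [metricForm_metricComp, metricForm_metricComp, hD x hx, hD x hx]
    exact (aux _ h2 _ _).symm

end Charts

/-! ### The tensor field on the manifold -/

section Global

variable {n : ℕ}

/-- If `ξ` is closed and the scalar curvature is constant, only the Cotton term of `Φ` is left. -/
theorem IsMetricOn.phi_of_closed {G : Coord n → Matrix (Fin n) (Fin n) ℝ} {U : Set (Coord n)}
    {X : Fin n → Coord n → ℝ} {c : ℝ} {x : Coord n} (h : IsMetricOn G U)
    (hcl : ∀ x ∈ U, ∀ i j, pd i (flat G X j) x = pd j (flat G X i) x)
    (hs : ∀ x ∈ U, scalarCurv G x = c) (hx : x ∈ U) (i k : Fin n) :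
    phi G X i k x = - ∑ l, cotton G k l i x * X l x := by
  have hΓ : ∀ y ∈ U, ∀ l i j, christoffel G l i j y = christoffel G l j i y :=
    fun y hy l i j => by
      rw [← connMap_stdVec, h.isLeviCivitaOn.conn_symm y hy, connMap_stdVec]
  have hP : ∀ y ∈ U, ∀ j k, skewPart G X j k y = 0 := fun y hy j k => by
    rw [skewPart, covDeriv₁, covDeriv₁, hcl y hy j k]
    simp only [hΓ y hy _ j k]
    ring
  have hpd : ∀ (u : Coord n → ℝ) (a : ℝ), (∀ y ∈ U, u y = a) → ∀ y ∈ U, ∀ i, pd i u y = 0 :=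
    fun u a hu y hy i => by
      rw [pd_eq_dirD, dirD_congr (Filter.mem_of_superset (h.isOpen.mem_nhds hy) hu),
        dirD_const]
  have hdiv : ∀ y ∈ U, ∀ k, divSkewPart G X k y = 0 := fun y hy k => by
    refine Finset.sum_eq_zero fun j _ => Finset.sum_eq_zero fun l _ => ?_
    rw [covDeriv₂, hpd _ 0 (fun z hz => hP z hz j k) y hy]
    simp [hP y hy]
  rw [phi, covDeriv₁, hpd _ 0 (fun z hz => hdiv z hz k) x hx, hpd _ c hs x hx]
  simp [hpd _ c hs x hx, hdiv x hx, hP x hx]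

variable {M : Type*} [TopologicalSpace M] [ChartedSpace (Coord n) M] [IsManifold (𝓡 n) ∞ M]

/-- The tensor field `L_g^* f` on `M`: at `p`, the bilinear form with components
`(L_g^* f)_{ij}` in the preferred chart at `p`. -/
def lStarTensor (g : Metric n M) (f : M → ℝ) : Tensor02 n M := fun p =>
  let D : Coord n →L[ℝ] Coord n := mfderiv (𝓡 n) (𝓡 n) (chartAt (Coord n) p) p
  (lStarForm (metricComp g (chartAt (Coord n) p)) (f ∘ (chartAt (Coord n) p).symm)
    (chartAt (Coord n) p p)).bilinearComp D D

theorem lStarTensor_apply (g : Metric n M) (f : M → ℝ) (p : M) (v w : TangentSpace (𝓡 n) p) :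
    lStarTensor g f p v w = lStarForm (metricComp g (chartAt (Coord n) p))
      (f ∘ (chartAt (Coord n) p).symm) (chartAt (Coord n) p p)
      (mfderiv (𝓡 n) (𝓡 n) (chartAt (Coord n) p) p v)
      (mfderiv (𝓡 n) (𝓡 n) (chartAt (Coord n) p) p w) := rfl

variable (g : Metric n M) {f : M → ℝ} {e : OpenPartialHomeomorph M (Coord n)} {x : Coord n}

/-- In every chart, the tensor field `L_g^* f` is computed by the coordinate formula. -/
theorem lStarTensor_chartSymmD (hf : ContMDiff (𝓡 n) 𝓘(ℝ) ∞ f) (he : IsChart e)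
    (hx : x ∈ e.target) (u v : Coord n) :
    lStarTensor g f (e.symm x) (chartSymmD e x u) (chartSymmD e x v)
      = lStarForm (metricComp g e) (f ∘ e.symm) x u v := by
  have he' := isChart_chartAt (n := n) (e.symm x)
  obtain ⟨hi, hD⟩ := isIsometryOn_transition g he he'
  have hsub : (e.symm.trans (chartAt (Coord n) (e.symm x))).source ⊆ e.target := fun y hy => by
    rw [e.symm.trans_source] at hy
    exact hy.1
  have hx' : x ∈ (e.symm.trans (chartAt (Coord n) (e.symm x))).source := by
    simpa using hx
  have key := hi.lStarForm_law (isMetricOn_metricComp g he) (isMetricOn_metricComp g he')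
    hsub hx' (f := f ∘ e.symm) (f' := f ∘ (chartAt (Coord n) (e.symm x)).symm)
    (fun y hy => he.contDiffAt_comp_symm hf hy)
    (fun y hy => he'.contDiffAt_comp_symm hf hy)
    (fun y hy => by
      have hy' : y ∈ e.target ∧ e.symm y ∈ (chartAt (Coord n) (e.symm x)).source := by
        simpa using hy
      simp [hy'.2]) u v
  rw [hD x hx', hD x hx'] at key
  exact key.symm

/-- The same formula at a given point `p`, with components taken by the derivative of the chart. -/
theorem lStarTensor_mfderiv (hf : ContMDiff (𝓡 n) 𝓘(ℝ) ∞ f) (he : IsChart e) {p : M}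
    (hp : p ∈ e.source) (v w : TangentSpace (𝓡 n) p) :
    lStarTensor g f p v w = lStarForm (metricComp g e) (f ∘ e.symm) (e p)
      (mfderiv (𝓡 n) (𝓡 n) e p v) (mfderiv (𝓡 n) (𝓡 n) e p w) := by
  obtain ⟨x, hx, rfl⟩ : ∃ x ∈ e.target, e.symm x = p := ⟨e p, e.map_source hp, e.left_inv hp⟩
  obtain ⟨a, rfl⟩ := (he.chartSymmD_bijective hx).2 v
  obtain ⟨b, rfl⟩ := (he.chartSymmD_bijective hx).2 w
  have h : ∀ a : Coord n, mfderiv (𝓡 n) (𝓡 n) e (e.symm x) (chartSymmD e x a) = a := fun a =>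
    congrArg (fun L => L a) (he.mdifferentiable.comp_symm_deriv hx)
  rw [lStarTensor_chartSymmD g hf he hx, h, h, e.right_inv hx]

theorem tensorComp_lStarTensor (hf : ContMDiff (𝓡 n) 𝓘(ℝ) ∞ f) (he : IsChart e)
    (hx : x ∈ e.target) (i k : Fin n) :
    tensorComp e (lStarTensor g f) i k x = lStar (metricComp g e) (f ∘ e.symm) i k x := by
  rw [tensorComp, coordVec_eq, coordVec_eq, lStarTensor_chartSymmD g hf he hx, lStarForm,
    bilForm_stdVec]

theorem lStarTensor_symm (hf : ContMDiff (𝓡 n) 𝓘(ℝ) ∞ f) (p : M) (v w : TangentSpace (𝓡 n) p) :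
    lStarTensor g f p v w = lStarTensor g f p w v := by
  have hp := (chartAt (Coord n) p).map_source (mem_chart_source (Coord n) p)
  rw [lStarTensor_apply, lStarTensor_apply]
  exact (isMetricOn_metricComp g (isChart_chartAt p)).lStarForm_symm hp
    ((isChart_chartAt p).contDiffAt_comp_symm hf hp) _ _

/-- Smoothness is read off in the trivialization of the tangent bundle given by the chart at `p`,
where the tensor field is the form `L_g^* f` of that chart. -/
theorem lStarTensor_smooth (hf : ContMDiff (𝓡 n) 𝓘(ℝ) ∞ f) : (lStarTensor g f).Smooth := by
  intro p
  rw [contMDiffAt_hom_bundle]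
  refine ⟨contMDiffAt_id, ?_⟩
  set e := chartAt (Coord n) p
  have he : IsChart e := isChart_chartAt p
  have hp : p ∈ e.source := mem_chart_source (Coord n) p
  have hform : ContDiffAt ℝ ∞ (lStarForm (metricComp g e) (f ∘ e.symm)) (e p) :=
    contDiffAt_bilForm (T := fun i j y => lStar (metricComp g e) (f ∘ e.symm) i j y)
      fun i j => (isMetricOn_metricComp g he).contDiffAt_lStar (e.map_source hp)
        (he.contDiffAt_comp_symm hf (e.map_source hp)) i j
  have hcomp : ContMDiffAt (𝓡 n) 𝓘(ℝ, Coord n →L[ℝ] Coord n →L[ℝ] ℝ) ∞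
      (fun q => lStarForm (metricComp g e) (f ∘ e.symm) (e q)) p :=
    hform.contMDiffAt.comp p (he.contMDiffAt hp)
  refine hcomp.congr_of_eventuallyEq ?_
  filter_upwards [e.open_source.mem_nhds hp] with q hq
  refine ContinuousLinearMap.ext fun u => ContinuousLinearMap.ext fun v => ?_
  have hb : q ∈ (trivializationAt (Coord n) (TangentSpace (𝓡 n) : M → Type _) p).baseSet := by
    simpa using hq
  refine (inCoordinates_apply_eq₂ (F₃ := ℝ) (E₃ := Bundle.Trivial M ℝ)
    hb hb (Set.mem_univ _)).trans ?_
  have hs : ∀ u, mfderiv (𝓡 n) (𝓡 n) e q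
      ((trivializationAt (Coord n) (TangentSpace (𝓡 n) : M → Type _) p).symm q u) = u := by
    intro u
    have h1 := (trivializationAt (Coord n) (TangentSpace (𝓡 n) : M → Type _)
      p).continuousLinearMapAt_symmL (R := ℝ) hb u
    rw [TangentBundle.continuousLinearMapAt_trivializationAt hq] at h1
    rw [Bundle.Trivialization.symmL_apply _ hb] at h1
    simp only [mfld_simps] at h1
    exact h1
  have h2 := lStarTensor_mfderiv g hf he hq
    ((trivializationAt (Coord n) (TangentSpace (𝓡 n) : M → Type _) p).symm q u)
    ((trivializationAt (Coord n) (TangentSpace (𝓡 n) : M → Type _) p).symm q v)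
  rw [hs, hs] at h2
  simpa using h2

end Global

end Riem

end

theorem mainTheorem4 {n : ℕ} (hn : 3 ≤ n) {M : Type*} [TopologicalSpace M]
    [ChartedSpace (Riem.Coord n) M] [IsManifold (𝓡 n) ∞ M] (g : Riem.Metric n M)
    (ξ : (p : M) → TangentSpace (𝓡 n) p) (f : M → ℝ) (hξ : Riem.IsConformal g ξ f) :
    ∃ Φ : Riem.Tensor02 n M, Φ.Smooth ∧ (∀ p v w, Φ p v w = Φ p w v) ∧
      (∀ e : OpenPartialHomeomorph M (Riem.Coord n), Riem.IsChart e → ∀ x ∈ e.target, ∀ i k,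
        Riem.tensorComp e Φ i k x
          = Riem.phi (Riem.metricComp g e) (Riem.vecComp e ξ) i k x) ∧
      (∀ e : OpenPartialHomeomorph M (Riem.Coord n), Riem.IsChart e → ∀ x ∈ e.target, ∀ i k,
        Riem.lStar (Riem.metricComp g e) (f ∘ e.symm) i k x = Riem.tensorComp e Φ i k x) ∧
      (∀ p, Riem.VacuumStaticAt g f p ↔ Φ p = 0) ∧
      (Riem.IsClosedField g ξ → Riem.HasConstantScalarCurvature g →
        ∀ e : OpenPartialHomeomorph M (Riem.Coord n), Riem.IsChart e → ∀ x ∈ e.target, ∀ i k,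
          Riem.tensorComp e Φ i k x
            = - ∑ l, Riem.cotton (Riem.metricComp g e) i l k x * Riem.vecComp e ξ l x) := by
  have hf := hξ.smooth_char
  have hphi : ∀ e : OpenPartialHomeomorph M (Riem.Coord n), Riem.IsChart e → ∀ x ∈ e.target,
      ∀ i k, Riem.lStar (Riem.metricComp g e) (f ∘ e.symm) i k x
        = Riem.phi (Riem.metricComp g e) (Riem.vecComp e ξ) i k x := fun e he x hx i k =>
    (Riem.isMetricOn_metricComp g he).lStar_eq_phi
      (fun y hy i => he.contDiffAt_vecComp hξ.smooth_field hy i)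
      (fun y hy => he.contDiffAt_comp_symm hf hy) (hξ.lie_eq e he) hx i k
  refine ⟨Riem.lStarTensor g f, Riem.lStarTensor_smooth g hf, Riem.lStarTensor_symm g hf,
    fun e he x hx i k => (Riem.tensorComp_lStarTensor g hf he hx i k).trans (hphi e he x hx i k),
    fun e he x hx i k => (Riem.tensorComp_lStarTensor g hf he hx i k).symm,
    fun p => ⟨fun hp => ?_, fun hp e he hpe i j => ?_⟩, fun hcl ⟨c, hc⟩ e he x hx i k => ?_⟩
  · have hps := mem_chart_source (Riem.Coord n) p
    have h0 : Riem.lStarForm (Riem.metricComp g (chartAt (Riem.Coord n) p))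
        (f ∘ (chartAt (Riem.Coord n) p).symm) (chartAt (Riem.Coord n) p p) = 0 := by
      refine Riem.bilForm_eq 0 fun i j => ?_
      have := hp _ (Riem.isChart_chartAt p) hps i j
      rw [Riem.lStar, this]
      simp [hps]
    refine ContinuousLinearMap.ext fun v => ContinuousLinearMap.ext fun w => ?_
    rw [Riem.lStarTensor_apply, h0]
    rfl
  · have h0 : Riem.lStarTensor g f (e.symm (e p)) = 0 := by rw [e.left_inv hpe]; exact hp
    have h1 := Riem.tensorComp_lStarTensor g hf he (e.map_source hpe) i j
    rw [Riem.tensorComp, h0] at h1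
    have h2 : Riem.lStar (Riem.metricComp g e) (f ∘ e.symm) i j (e p) = 0 := h1.symm
    rw [Riem.lStar, Function.comp_apply, e.left_inv hpe] at h2
    linarith
  · rw [Riem.tensorComp, Riem.lStarTensor_symm g hf, ← Riem.tensorComp,
      Riem.tensorComp_lStarTensor g hf he hx, hphi e he x hx]
    exact (Riem.isMetricOn_metricComp g he).phi_of_closed (hcl e he) (hc e he) hx k i
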